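/- **Setting.** Algebraic groups over a field $k$ of characteristic $0$ are given by their functors of points on commutative $k$-algebras, and homomorphisms are natural transformations. Let $\overline{\mathbb Q}$ be the algebraic closure of $\mathbb Q$ in $\mathbb C$ and $\iota$ complex conjugation. For a number field $L$ let $T^L=\mathrm{Res}_{L/\mathbb Q}\mathbb G_{m,L}$, so that $T^L(R)=(L\otimes_{\mathbb Q}R)^\times$ and $X^*(T^L)=\mathbb Z^{\mathrm{Hom}(L,\overline{\mathbb Q})}$, with $(\sigma f)(\rho)=f(\sigma^{-1}\circ\rho)$. The Serre group $S^L$ is the group of multiplicative type over $\mathbb Q$ whose character group is $$X^*(S^L)=\{f\in X^*(T^L) : (\sigma-1)(\iota+1)f=0=(\iota+1)(\sigma-1)f\ \ \forall \sigma\in \mathrm{Gal}(\overline{\mathbb Q}/\mathbb Q)\},$$ and $\pi^L:T^L\to S^L$ is the quotient map dual to the inclusion of character groups. For $L\subset L'$ the norm $N_{L'/L}:S^{L'}\to S^L$ is given on characters by $f\mapsto(\rho\mapsto f(\rho|_L))$. For a set $\Phi\subset\mathrm{Hom}(L,\overline{\mathbb Q})$ let $\mu_\Phi:\mathbb G_{m,\overline{\mathbb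 Q}}\to T^L_{\overline{\mathbb Q}}\cong\prod_{\phi}\mathbb G_{m,\overline{\mathbb Q}}$ be the cocharacter with component $z$ at $\phi\in\Phi$ and $1$ at $\phi\notin\Phi$. For an embedding $\tau:L\to\overline{\mathbb Q}$ put $\mu_\tau=\mu_{\{\tau\}}$ and $\mu^L=\pi^L\circ\mu_\tau$. Let $K$ be a number field that contains a CM field, with an embedding $\tau:K\to\overline{\mathbb Q}$, and let $E\subset K$ be its maximal CM subfield. Let $(E_i,\Phi_i)$, $1\le i\le r$, be CM types: $E_i$ is a CM field, $\Phi_i\subset\mathrm{Hom}(E_i,\overline{\mathbb Q})$, $\Phi_i\cup\iota\Phi_i=\mathrm{Hom}(E_i,\overline{\mathbb Q})$, $\Phi_i\cap\iota\Phi_i=\emptyset$. Let $E_i^*\subset\overline{\mathbb Q}$ be the reflex field, generated over $\mathbb Q$ by the elements $\sum_{\phi\in\Phi_i}\phi(e)$, $e\in E_i$, and assume that $E_i^*\subset\tau(E)$ for all $i$. (It is not necessary that the CM types be primitive or that the map $S^E\to\prod_iT^{E_i}$ below be injective.) Choose $\xi_i\in E_i$ with $\xi_i^\iota=-\xi_i$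 and $E_i=\mathbb Q(\xi_i)$, and let $(V_E,\psi_E)$ be the orthogonal sum of the spaces $E_i$ with the forms $\psi_i(x,y)=\mathrm{Tr}_{E_i/\mathbb Q}(\xi_i x y^\iota)$. Let $GSp=GSp(V_E,\psi_E)$, and let $\mathcal T\subset\prod_iT^{E_i}$ be the subgroup with $$\mathcal T(R)=\{(x_i)_i : \text{there is } \nu\in R^\times \text{ with } x_ix_i^\iota=\nu \text{ for all } i\};$$ it acts on $V_E$ by multiplication, which gives a homomorphism $\mathfrak i:\mathcal T\to GSp$. *The homomorphism $\varphi$.* Let $\rho_{\Phi_i}:S^{E_i^*}\to T^{E_i}$ be the homomorphism over $\mathbb Q$ with $\mu_{\Phi_i}=\rho_{\Phi_i,\overline{\mathbb Q}}\circ\mu^{E_i^*}$ (where $E_i^*$ is embedded in $\overline{\mathbb Q}$ by the inclusion). The homomorphism $(\rho_{\Phi_i}\circ N_{E/E_i^*})_i:S^E\to\prod_iT^{E_i}$ has image in $\mathcal T$, and $\varphi$ is the composite $$T^K\xrightarrow{\ \pi^K\ }S^K\xrightarrow{\ N_{K/E}\ }S^E\xrightarrow{\ (\rho_{\Phi_i}\circ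 N_{E/E_i^*})_i\ }\mathcal T\xrightarrow{\ \mathfrak i\ }GSp.$$ *The homomorphism $\eta$.* The cocharacter $\mu'_{cm}=\prod_i\mu_{\Phi_i}$ has image in $\mathcal T$ and is defined over $K$ (embedded by $\tau$), that is, it comes from a homomorphism $\mu'_{cm}:\mathbb G_{m,K}\to\mathcal T_K$; and $\eta$ is the composite $$T^K\xrightarrow{\ \mathrm{Res}_{K/\mathbb Q}(\mu'_{cm})\ }\mathrm{Res}_{K/\mathbb Q}(\mathcal T_K)\xrightarrow{\ Nm_{K/\mathbb Q}\ }\mathcal T\xrightarrow{\ \mathfrak i\ }GSp,$$ where $Nm_{K/\mathbb Q}$ is induced by the norms of the algebras $E_i\otimes(K\otimes R)$ over $E_i\otimes R$. **Proposition.** Both descriptions determine a homomorphism of algebraic groups over $\mathbb Q$: there is exactly one $\varphi$ and exactly one $\eta:T^K\to GSp(V_E,\psi_E)$ as described. These two homomorphisms are equal: $\varphi=\eta$. -/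

import Mathlib

open CategoryTheory TensorProduct

noncomputable section

/-! ### The algebraic closure of `ℚ` in `ℂ` -/

/-- The algebraic closure of `ℚ` in `ℂ`. -/
def QBar : Type := algebraicClosure ℚ ℂ

instance QBar.instField : Field QBar := inferInstanceAs (Field (algebraicClosure ℚ ℂ))

instance QBar.instCharZero : CharZero QBar := inferInstanceAs (CharZero (algebraicClosure ℚ ℂ))

/-- The inclusion `QBar → ℂ`. -/
def QBar.val : QBar →+* ℂ := (algebraicClosure ℚ ℂ).val.toRingHom

instance QBar.instIsAlgClosed : IsAlgClosed QBar :=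
  (algebraicClosure.isAlgClosure (F := ℚ) (E := ℂ)).isAlgClosed

/-- Complex conjugation `ι` on `QBar`. -/
def conjQBar : QBar ≃ₐ[ℚ] QBar :=
  RingEquiv.toRatAlgEquiv (R := QBar) (S := QBar)
    ((Complex.conjAe.restrictScalars ℚ).algebraicClosure : _ ≃ₐ[ℚ] _).toRingEquiv

theorem val_conjQBar (x : QBar) : QBar.val (conjQBar x) = starRingEnd ℂ (QBar.val x) := rfl

/-! ### Group functors, extension of scalars, Weil restriction

Algebraic groups are given by their functors of points, and homomorphisms of algebraic groups are
natural transformations. -/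

/-- Commutative `ℚ`-algebras. -/
abbrev QAlg := CommAlgCat.{0} ℚ

/-- Group functors over `ℚ`. -/
abbrev QGroup := QAlg ⥤ GrpCat.{0}

/-- Commutative `K`-algebras: a `K`-algebra is a `ℚ`-algebra `A` together with a
homomorphism `K → A` of `ℚ`-algebras. -/
abbrev AlgOver (K : Type) [Field K] [CharZero K] := Under (CommAlgCat.of ℚ K)

/-- Group functors over `K`. -/
abbrev GroupOver (K : Type) [Field K] [CharZero K] := AlgOver K ⥤ GrpCat.{0}

/-- The multiplicative group `R ↦ Rˣ`. -/
def Gm : QGroup where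
  obj R := GrpCat.of Rˣ
  map f := GrpCat.ofHom (Units.map (f.hom : _ →* _))

/-- Extension of scalars `G_K`. -/
def extendScalars (K : Type) [Field K] [CharZero K] (G : QGroup) : GroupOver K :=
  Under.forget (CommAlgCat.of ℚ K) ⋙ G

/-- Extension of scalars for homomorphisms. -/
def extendScalarsMap (K : Type) [Field K] [CharZero K] {G H : QGroup} (f : G ⟶ H) :
    extendScalars K G ⟶ extendScalars K H :=
  Functor.whiskerLeft (Under.forget (CommAlgCat.of ℚ K)) f

/-- The functor `R ↦ K ⊗ R` from `ℚ`-algebras to `K`-algebras. -/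
def tensorFunctor (K : Type) [Field K] [CharZero K] : QAlg ⥤ AlgOver K where
  obj R := Under.mk (CommAlgCat.ofHom
    (Algebra.TensorProduct.includeLeft : K →ₐ[ℚ] K ⊗[ℚ] R))
  map {R S} f := Under.homMk (CommAlgCat.ofHom
    (Algebra.TensorProduct.map (AlgHom.id ℚ K) f.hom)) (by ext x; simp)
  map_id R := by
    ext x
    simp
  map_comp f g := by
    apply Under.UnderMorphism.ext
    apply CommAlgCat.hom_ext
    apply Algebra.TensorProduct.ext <;> ext x <;> simp

/-- The Weil restriction `Res_{K/ℚ} G : R ↦ G(K ⊗ R)`. -/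
def weilRestriction (K : Type) [Field K] [CharZero K] (G : GroupOver K) : QGroup :=
  tensorFunctor K ⋙ G

/-- Weil restriction for homomorphisms. -/
def weilRestrictionMap (K : Type) [Field K] [CharZero K] {G H : GroupOver K} (f : G ⟶ H) :
    weilRestriction K G ⟶ weilRestriction K H :=
  Functor.whiskerLeft (tensorFunctor K) f

/-- The torus `T^K = Res_{K/ℚ} 𝔾_{m,K}`, with `T^K(R) = (K ⊗ R)ˣ`. -/
abbrev torus (K : Type) [Field K] [CharZero K] : QGroup :=
  weilRestriction K (extendScalars K Gm)

/-! ### The splitting `K ⊗ A ≃ ∏_{ρ : K → QBar} A` over a `QBar`-algebra, and cocharacters -/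

section Split

variable (K : Type) [Field K] [NumberField K]

/-- `k ⊗ a ↦ (ρ(k) a)_ρ`, where `A` is a `QBar`-algebra by means of `u`. -/
def splitHom (A : Type) [CommRing A] [Algebra ℚ A] (u : QBar →ₐ[ℚ] A) :
    K ⊗[ℚ] A →ₐ[ℚ] ((K →ₐ[ℚ] QBar) → A) :=
  AlgHom.pi fun ρ =>
    Algebra.TensorProduct.lift (u.comp ρ) (AlgHom.id ℚ A) fun _ _ => mul_comm _ _

theorem splitHom_bijective (A : Type) [CommRing A] [Algebra ℚ A] (u : QBar →ₐ[ℚ] A) :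
    Function.Bijective (splitHom K A u) := by
  classical
  let b := Module.finBasis ℚ K
  have hcard : Fintype.card (Fin (Module.finrank ℚ K)) = Fintype.card (K →ₐ[ℚ] QBar) := by
    rw [Fintype.card_fin, AlgHom.card]
  let e := Fintype.equivOfCardEq hcard
  let M := Algebra.embeddingsMatrixReindex ℚ QBar b e
  have hM : IsUnit M.det := by
    rw [isUnit_iff_ne_zero]
    intro h0
    have h := Algebra.discr_eq_det_embeddingsMatrixReindex_pow_two ℚ QBar b e
    rw [show (Algebra.embeddingsMatrixReindex ℚ QBar (⇑b) e).det = 0 from h0] at h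
    have := Algebra.discr_not_zero_of_basis ℚ b
    simp at h
    exact this h
  let N : Matrix (Fin (Module.finrank ℚ K)) (Fin (Module.finrank ℚ K)) A := (M.map u).transpose
  have hN : IsUnit N.det := by
    have : N.det = u M.det := by
      rw [Matrix.det_transpose]
      exact (AlgHom.map_det u M).symm
    rw [this]; exact hM.map u
  let g : K ⊗[ℚ] A ≃ₗ[ℚ] (Fin (Module.finrank ℚ K) → A) :=
    ((TensorProduct.comm ℚ K A).trans ((b.baseChange A).equivFun.restrictScalars ℚ))
  have hbij : Function.Bijective (fun v : Fin (Module.finrank ℚ K) → A => N.mulVec v) := by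
    have hu : IsUnit N := (Matrix.isUnit_iff_isUnit_det N).2 hN
    exact ⟨Matrix.mulVec_injective_of_isUnit hu, Matrix.mulVec_surjective_iff_isUnit.2 hu⟩
  have key : ∀ x i, splitHom K A u x (e i) = N.mulVec (g x) i := by
    intro x i
    induction x with
    | zero => simp
    | add x y hx hy => simp only [map_add, Pi.add_apply, hx, hy, Matrix.mulVec_add]
    | tmul k a =>
      have hk : k = ∑ j, b.repr k j • b j := (b.sum_repr k).symm
      have h1 : splitHom K A u (k ⊗ₜ a) (e i) = u (e i k) * a := rfl
      have h2 : ∀ j, g (k ⊗ₜ a) j = b.repr k j • a := fun j => by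
        simp [g, Module.Basis.baseChange]
      have h3 : ∀ j, N i j = u (e i (b j)) := fun j => rfl
      simp only [h1, Matrix.mulVec, dotProduct, h2, h3]
      conv_lhs => rw [hk]
      simp only [map_sum, Finset.sum_mul]
      refine Finset.sum_congr rfl fun j _ => ?_
      have h4 : u (e i (b.repr k j • b j)) = b.repr k j • u (e i (b j)) := by
        rw [← AlgHom.comp_apply, map_smul, AlgHom.comp_apply]
      rw [h4, smul_mul_assoc, mul_smul_comm]
  have key' : (splitHom K A u : _ → _) =
      (fun (v : Fin (Module.finrank ℚ K) → A) ρ => v (e.symm ρ)) ∘ (fun v => N.mulVec v) ∘ g := by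
    funext x ρ
    have := key x (e.symm ρ)
    rw [Equiv.apply_symm_apply] at this
    exact this
  rw [key']
  exact (Equiv.bijective (Equiv.arrowCongr e (Equiv.refl A))).comp (hbij.comp g.bijective)

/-- The isomorphism `K ⊗ A ≃ ∏_ρ A` for a `QBar`-algebra `A`. -/
def splitEquiv (A : Type) [CommRing A] [Algebra ℚ A] (u : QBar →ₐ[ℚ] A) :
    K ⊗[ℚ] A ≃ₐ[ℚ] ((K →ₐ[ℚ] QBar) → A) :=
  AlgEquiv.ofBijective (splitHom K A u) (splitHom_bijective K A u)

theorem splitEquiv_map {A B : Type} [CommRing A] [Algebra ℚ A] [CommRing B] [Algebra ℚ B]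
    (u : QBar →ₐ[ℚ] A) (v : QBar →ₐ[ℚ] B) (f : A →ₐ[ℚ] B) (h : ∀ q, f (u q) = v q)
    (x : K ⊗[ℚ] A) (φ : K →ₐ[ℚ] QBar) :
    splitEquiv K B v (Algebra.TensorProduct.map (AlgHom.id ℚ K) f x) φ =
      f (splitEquiv K A u x φ) := by
  induction x with
  | zero => simp
  | add x y hx hy => simp only [map_add, Pi.add_apply, hx, hy]
  | tmul k a =>
    change v (φ k) * f a = f (u (φ k) * a)
    rw [map_mul, h]

open Classical in
/-- The element `(z)_{φ ∈ Φ} × (1)_{φ ∉ Φ}` of `∏_φ A ≃ K ⊗ A`. -/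
def muPhiPoints (Φ : Set (K →ₐ[ℚ] QBar)) (A : Type) [CommRing A] [Algebra ℚ A]
    (u : QBar →ₐ[ℚ] A) : Aˣ →* (K ⊗[ℚ] A)ˣ :=
  (Units.map ((splitEquiv K A u).symm.toMulEquiv.toMonoidHom)).comp
    ((MulEquiv.piUnits (M := fun _ : K →ₐ[ℚ] QBar => A)).symm.toMonoidHom.comp
      { toFun z φ := if φ ∈ Φ then z else 1
        map_one' := by funext φ; simp
        map_mul' z w := by funext φ; by_cases h : φ ∈ Φ <;> simp [h] })

open Classical in
theorem splitEquiv_muPhiPoints (Φ : Set (K →ₐ[ℚ] QBar)) (A : Type) [CommRing A] [Algebra ℚ A]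
    (u : QBar →ₐ[ℚ] A) (z : Aˣ) (φ : K →ₐ[ℚ] QBar) :
    splitEquiv K A u (muPhiPoints K Φ A u z : K ⊗[ℚ] A) φ = if φ ∈ Φ then (z : A) else 1 := by
  change splitEquiv K A u ((splitEquiv K A u).symm _) φ = _
  rw [AlgEquiv.apply_symm_apply]
  change ((if φ ∈ Φ then z else 1 : Aˣ) : A) = _
  split_ifs <;> simp

theorem muPhiPoints_map (Φ : Set (K →ₐ[ℚ] QBar)) {A B : Type} [CommRing A] [Algebra ℚ A]
    [CommRing B] [Algebra ℚ B] (u : QBar →ₐ[ℚ] A) (v : QBar →ₐ[ℚ] B) (f : A →ₐ[ℚ] B)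
    (h : ∀ q, f (u q) = v q) (z : Aˣ) :
    muPhiPoints K Φ B v (Units.map (f : A →* B) z) =
      Units.map (Algebra.TensorProduct.map (AlgHom.id ℚ K) f : _ →* _) (muPhiPoints K Φ A u z) := by
  apply Units.ext
  apply (splitEquiv K B v).injective
  funext φ
  refine (splitEquiv_muPhiPoints K Φ B v _ φ).trans ?_
  refine Eq.trans ?_ (splitEquiv_map K u v f h _ φ).symm
  rw [splitEquiv_muPhiPoints]
  split_ifs
  · rfl
  · exact (map_one f).symm

/-- For a set `Φ` of embeddings `K → QBar`, the cocharacter `μ_Φ` of `T^K` over `QBar`: it sends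
`z` to the element whose component at `φ` is `z` if `φ ∈ Φ`, and `1` otherwise. -/
def muPhi (Φ : Set (K →ₐ[ℚ] QBar)) :
    extendScalars QBar Gm ⟶ extendScalars QBar (torus K) where
  app A := GrpCat.ofHom (muPhiPoints K Φ A.right A.hom.hom)
  naturality A B f := by
    refine GrpCat.hom_ext (MonoidHom.ext fun z => ?_)
    exact muPhiPoints_map K Φ A.hom.hom B.hom.hom f.right.hom
      (fun q => congrArg (fun h => h.hom q) (Under.w f)) z

end Split

/-! ### CM types and reflex fields -/

section CM

variable (E : Type) [Field E] [NumberField E]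

/-- `Φ` is a CM type on the CM field `E`: `Φ ∪ ιΦ = Hom(E, QBar)` and `Φ ∩ ιΦ = ∅`. -/
structure IsCMType [NumberField.IsCMField E] (Φ : Set (E →ₐ[ℚ] QBar)) : Prop where
  union_conj : Φ ∪ (fun φ => (conjQBar : QBar →ₐ[ℚ] QBar).comp φ) '' Φ = Set.univ
  inter_conj : Φ ∩ (fun φ => (conjQBar : QBar →ₐ[ℚ] QBar).comp φ) '' Φ = ∅

variable {E}

/-- The reflex field `E^*`: the subfield of `QBar` generated by the sums `∑_{φ ∈ Φ} φ(e)`. -/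
def reflexField (Φ : Set (E →ₐ[ℚ] QBar)) : IntermediateField ℚ QBar :=
  IntermediateField.adjoin ℚ (Set.range fun e : E => ∑ᶠ φ ∈ Φ, φ e)

instance reflexField.instNumberField (Φ : Set (E →ₐ[ℚ] QBar)) :
    NumberField (reflexField Φ) := by
  have hfin : FiniteDimensional ℚ (⨆ φ : E →ₐ[ℚ] QBar, φ.fieldRange : IntermediateField ℚ QBar) :=
    have : ∀ φ : E →ₐ[ℚ] QBar, FiniteDimensional ℚ φ.fieldRange := fun φ =>
      (AlgEquiv.ofInjectiveField φ).toLinearEquiv.finiteDimensional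
    IntermediateField.finiteDimensional_iSup_of_finite
  have hle : reflexField Φ ≤ ⨆ φ : E →ₐ[ℚ] QBar, φ.fieldRange := by
    refine IntermediateField.adjoin_le_iff.2 ?_
    rintro _ ⟨e, rfl⟩
    change ∑ᶠ φ ∈ Φ, φ e ∈ _
    rw [finsum_mem_eq_finite_toFinset_sum _ (Set.toFinite Φ)]
    exact sum_mem fun φ _ => le_iSup (fun φ : E →ₐ[ℚ] QBar => φ.fieldRange) φ ⟨e, rfl⟩
  have : FiniteDimensional ℚ (reflexField Φ) :=
    FiniteDimensional.of_injective (IntermediateField.inclusion hle).toLinearMap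
      (IntermediateField.inclusion hle).injective
  exact { to_finiteDimensional := by convert this }

/-- The inclusion `E^* → QBar`. -/
def reflexField.incl (Φ : Set (E →ₐ[ℚ] QBar)) : reflexField Φ →ₐ[ℚ] QBar :=
  ((reflexField Φ).val : reflexField Φ →+* QBar).toRatAlgHom

/-- Complex conjugation of the CM field `E`. -/
def conjCM (E : Type) [Field E] [NumberField E] [NumberField.IsCMField E] : E →ₐ[ℚ] E :=
  (NumberField.IsCMField.complexConj E).toRingEquiv.toRingHom.toRatAlgHom

/-- If `F ⊆ τ(E)`, the inclusion `F → E` that `τ` gives, for subfields `E` of `K` and `F`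
of `QBar`. -/
def inclOfLE {K : Type} [Field K] [NumberField K] (τ : K →ₐ[ℚ] QBar)
    (E : IntermediateField ℚ K) (F : IntermediateField ℚ QBar) (h : F ≤ E.map τ) : F →ₐ[ℚ] E :=
  ((E.equivMap τ).symm.toRingEquiv.toRingHom.comp
    (IntermediateField.inclusion h).toRingHom).toRatAlgHom

theorem inclOfLE_spec {K : Type} [Field K] [NumberField K] (τ : K →ₐ[ℚ] QBar)
    (E : IntermediateField ℚ K) (F : IntermediateField ℚ QBar) (h : F ≤ E.map τ) (x : F) :
    τ (inclOfLE τ E F h x : K) = (x : QBar) :=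
  congrArg Subtype.val ((E.equivMap τ).apply_symm_apply (IntermediateField.inclusion h x))

/-- The inclusion of a subfield `E` of `K`. -/
def subfieldIncl {K : Type} [Field K] [NumberField K] (E : IntermediateField ℚ K) : E →ₐ[ℚ] K :=
  (E.val : E →+* K).toRatAlgHom

end CM

/-! ### The Serre group -/

section Serre

variable (K : Type) [Field K] [NumberField K]

/-- The action of `σ ∈ Gal(QBar/ℚ)` on `X^*(T^K) = ℤ^{Hom(K, QBar)}`, namely
`(σ f)(ρ) = f(σ⁻¹ ∘ ρ)`. -/
def galAct (σ : QBar ≃ₐ[ℚ] QBar) : ((K →ₐ[ℚ] QBar) → ℤ) →+ ((K →ₐ[ℚ] QBar) → ℤ) where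
  toFun f ρ := f ((σ.symm : QBar →ₐ[ℚ] QBar).comp ρ)
  map_zero' := rfl
  map_add' _ _ := rfl

theorem galAct_mul (σ s : QBar ≃ₐ[ℚ] QBar) (f : (K →ₐ[ℚ] QBar) → ℤ) :
    galAct K (σ * s) f = galAct K σ (galAct K s f) := rfl

/-- The Serre condition `(σ - 1)(ι + 1) f = 0 = (ι + 1)(σ - 1) f` for all `σ`. -/
def SerreCondition (f : (K →ₐ[ℚ] QBar) → ℤ) : Prop :=
  ∀ σ : QBar ≃ₐ[ℚ] QBar,
    galAct K σ (galAct K conjQBar f + f) - (galAct K conjQBar f + f) = 0 ∧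
    galAct K conjQBar (galAct K σ f - f) + (galAct K σ f - f) = 0

/-- The character group `X^*(S^K) ⊆ X^*(T^K)` of the Serre group. -/
def serreLattice : AddSubgroup ((K →ₐ[ℚ] QBar) → ℤ) where
  carrier := {f | SerreCondition K f}
  zero_mem' σ := by simp
  add_mem' {f g} hf hg σ := by
    obtain ⟨a, b⟩ := hf σ
    obtain ⟨c, d⟩ := hg σ
    constructor
    · rw [← add_zero (0 : (K →ₐ[ℚ] QBar) → ℤ)]
      nth_rewrite 1 [← a]
      rw [← c]
      simp only [map_add]
      abel
    · rw [← add_zero (0 : (K →ₐ[ℚ] QBar) → ℤ)]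
      nth_rewrite 1 [← b]
      rw [← d]
      simp only [map_add, map_sub]
      abel
  neg_mem' {f} hf σ := by
    obtain ⟨a, b⟩ := hf σ
    constructor
    · rw [← neg_zero, ← a]
      simp only [map_add, map_neg]
      abel
    · rw [← neg_zero, ← b]
      simp only [map_sub, map_neg]
      abel

/-- The Galois action on `X^*(S^K)`. -/
def serreAct (s : QBar ≃ₐ[ℚ] QBar) : serreLattice K →+ serreLattice K :=
  ((galAct K s).comp (serreLattice K).subtype).codRestrict (serreLattice K) fun f σ => by
    have hf : SerreCondition K f := f.2
    have h1 : ∀ t, galAct K t (galAct K conjQBar f) + galAct K t f =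
        galAct K conjQBar f + f := fun t => by
      have := (hf t).1
      rw [map_add] at this
      exact sub_eq_zero.1 this
    have h2 : ∀ t, galAct K conjQBar (galAct K t f) + galAct K t f =
        galAct K conjQBar f + f := fun t => by
      have := (hf t).2
      rw [map_sub] at this
      rw [← sub_eq_zero, ← this]
      abel
    change galAct K σ (galAct K conjQBar (galAct K s f) + galAct K s f) -
        (galAct K conjQBar (galAct K s f) + galAct K s f) = 0 ∧
      galAct K conjQBar (galAct K σ (galAct K s f) - galAct K s f) +
        (galAct K σ (galAct K s f) - galAct K s f) = 0
    refine ⟨?_, ?_⟩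
    · rw [h2, map_add, h1, sub_self]
    · have h3 := h2 (σ * s)
      rw [galAct_mul, ← h2 s] at h3
      rw [map_sub, ← sub_eq_zero.2 h3]
      abel

/-- The action of `σ ∈ Gal(QBar/ℚ)` on `(QBar ⊗ R)ˣ`. -/
def galUnits (R : Type) [CommRing R] [Algebra ℚ R] (σ : QBar ≃ₐ[ℚ] QBar) :
    (QBar ⊗[ℚ] R)ˣ →* (QBar ⊗[ℚ] R)ˣ :=
  Units.map (Algebra.TensorProduct.map (σ : QBar →ₐ[ℚ] QBar) (AlgHom.id ℚ R) : _ →* _)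

/-- The points of the Serre group: Galois equivariant homomorphisms
`X^*(S^K) → (QBar ⊗ R)ˣ`. -/
def serrePoints (R : Type) [CommRing R] [Algebra ℚ R] :
    Subgroup (Multiplicative (serreLattice K) →* (QBar ⊗[ℚ] R)ˣ) where
  carrier := {χ | ∀ (σ : QBar ≃ₐ[ℚ] QBar) (m : serreLattice K),
    χ (Multiplicative.ofAdd (serreAct K σ m)) = galUnits R σ (χ (Multiplicative.ofAdd m))}
  one_mem' σ m := by simp
  mul_mem' ha hb σ m := by simp [ha σ m, hb σ m]
  inv_mem' ha σ m := by simp [ha σ m]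

/-- The map `(QBar ⊗ R)ˣ → (QBar ⊗ S)ˣ` of a homomorphism `R → S`. -/
def qbarUnitsMap {R S : Type} [CommRing R] [CommRing S] [Algebra ℚ R] [Algebra ℚ S]
    (g : R →ₐ[ℚ] S) : (QBar ⊗[ℚ] R)ˣ →* (QBar ⊗[ℚ] S)ˣ :=
  Units.map (Algebra.TensorProduct.map (AlgHom.id ℚ QBar) g : _ →* _)

theorem qbarUnitsMap_id {R : Type} [CommRing R] [Algebra ℚ R] (x : (QBar ⊗[ℚ] R)ˣ) :
    qbarUnitsMap (AlgHom.id ℚ R) x = x := by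
  apply Units.ext
  change Algebra.TensorProduct.map (AlgHom.id ℚ QBar) (AlgHom.id ℚ R) (x : QBar ⊗[ℚ] R) = _
  rw [Algebra.TensorProduct.map_id]
  rfl

theorem qbarUnitsMap_comp {R S T : Type} [CommRing R] [CommRing S] [CommRing T] [Algebra ℚ R]
    [Algebra ℚ S] [Algebra ℚ T] (f : R →ₐ[ℚ] S) (g : S →ₐ[ℚ] T) (x : (QBar ⊗[ℚ] R)ˣ) :
    qbarUnitsMap (g.comp f) x = qbarUnitsMap g (qbarUnitsMap f x) := by
  apply Units.ext
  change Algebra.TensorProduct.map (AlgHom.id ℚ QBar) (g.comp f) (x : QBar ⊗[ℚ] R) =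
    Algebra.TensorProduct.map (AlgHom.id ℚ QBar) g
      (Algebra.TensorProduct.map (AlgHom.id ℚ QBar) f (x : QBar ⊗[ℚ] R))
  rw [← AlgHom.comp_apply, ← Algebra.TensorProduct.map_comp]
  rfl

theorem qbarUnitsMap_galUnits {R S : Type} [CommRing R] [CommRing S] [Algebra ℚ R] [Algebra ℚ S]
    (g : R →ₐ[ℚ] S) (σ : QBar ≃ₐ[ℚ] QBar) (x : (QBar ⊗[ℚ] R)ˣ) :
    qbarUnitsMap g (galUnits R σ x) = galUnits S σ (qbarUnitsMap g x) := by
  apply Units.ext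
  change Algebra.TensorProduct.map (AlgHom.id ℚ QBar) g
      (Algebra.TensorProduct.map (σ : QBar →ₐ[ℚ] QBar) (AlgHom.id ℚ R) (x : QBar ⊗[ℚ] R)) =
    Algebra.TensorProduct.map (σ : QBar →ₐ[ℚ] QBar) (AlgHom.id ℚ S)
      (Algebra.TensorProduct.map (AlgHom.id ℚ QBar) g (x : QBar ⊗[ℚ] R))
  generalize (x : QBar ⊗[ℚ] R) = y
  induction y with
  | zero => simp
  | add x y hx hy => simp only [map_add, hx, hy]
  | tmul q r => simp

/-- The Serre group `S^K`: the group of multiplicative type over `ℚ` with character group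
`X^*(S^K)`. -/
def serreGroup : QGroup where
  obj R := GrpCat.of (serrePoints K R)
  map {R S} g := GrpCat.ofHom
    { toFun χ := ⟨(qbarUnitsMap g.hom).comp χ.1, fun σ m => by
        simp only [MonoidHom.comp_apply, χ.2 σ m, qbarUnitsMap_galUnits]⟩
      map_one' := by ext; simp
      map_mul' χ χ' := by ext; simp }
  map_id R := by
    refine GrpCat.hom_ext (MonoidHom.ext fun χ => Subtype.ext (MonoidHom.ext fun m => ?_))
    exact qbarUnitsMap_id _
  map_comp f g := by
    refine GrpCat.hom_ext (MonoidHom.ext fun χ => Subtype.ext (MonoidHom.ext fun m => ?_))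
    exact qbarUnitsMap_comp f.hom g.hom _

/-- The value of the character `[ρ]` of `T^K`: the map `(K ⊗ R)ˣ → (QBar ⊗ R)ˣ` induced
by `ρ`. -/
def embUnits {R : Type} [CommRing R] [Algebra ℚ R] (ρ : K →ₐ[ℚ] QBar) :
    (K ⊗[ℚ] R)ˣ →* (QBar ⊗[ℚ] R)ˣ :=
  Units.map (Algebra.TensorProduct.map ρ (AlgHom.id ℚ R) : _ →* _)

theorem galUnits_embUnits {R : Type} [CommRing R] [Algebra ℚ R] (σ : QBar ≃ₐ[ℚ] QBar)
    (ρ : K →ₐ[ℚ] QBar) (a : (K ⊗[ℚ] R)ˣ) :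
    galUnits R σ (embUnits K ρ a) = embUnits K ((σ : QBar →ₐ[ℚ] QBar).comp ρ) a := by
  apply Units.ext
  change Algebra.TensorProduct.map (σ : QBar →ₐ[ℚ] QBar) (AlgHom.id ℚ R)
      (Algebra.TensorProduct.map ρ (AlgHom.id ℚ R) (a : K ⊗[ℚ] R)) =
    Algebra.TensorProduct.map ((σ : QBar →ₐ[ℚ] QBar).comp ρ) (AlgHom.id ℚ R) (a : K ⊗[ℚ] R)
  generalize (a : K ⊗[ℚ] R) = y
  induction y with
  | zero => simp
  | add x y hx hy => simp only [map_add, hx, hy]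
  | tmul q r => simp

theorem qbarUnitsMap_embUnits {R S : Type} [CommRing R] [CommRing S] [Algebra ℚ R] [Algebra ℚ S]
    (g : R →ₐ[ℚ] S) (ρ : K →ₐ[ℚ] QBar) (a : (K ⊗[ℚ] R)ˣ) :
    embUnits K ρ (Units.map (Algebra.TensorProduct.map (AlgHom.id ℚ K) g : _ →* _) a) =
      qbarUnitsMap g (embUnits K ρ a) := by
  apply Units.ext
  change Algebra.TensorProduct.map ρ (AlgHom.id ℚ S)
      (Algebra.TensorProduct.map (AlgHom.id ℚ K) g (a : K ⊗[ℚ] R)) =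
    Algebra.TensorProduct.map (AlgHom.id ℚ QBar) g
      (Algebra.TensorProduct.map ρ (AlgHom.id ℚ R) (a : K ⊗[ℚ] R))
  generalize (a : K ⊗[ℚ] R) = y
  induction y with
  | zero => simp
  | add x y hx hy => simp only [map_add, hx, hy]
  | tmul q r => simp

/-- The homomorphism `(K ⊗ R)ˣ → Hom(X^*(T^K), (QBar ⊗ R)ˣ)` that evaluates characters:
`a ↦ (f ↦ ∏_ρ ρ(a)^{f(ρ)})`. -/
def evalChar (R : Type) [CommRing R] [Algebra ℚ R] :
    (K ⊗[ℚ] R)ˣ →* (Multiplicative ((K →ₐ[ℚ] QBar) → ℤ) →* (QBar ⊗[ℚ] R)ˣ) where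
  toFun a :=
    { toFun f := ∏ ρ, embUnits K ρ a ^ f.toAdd ρ
      map_one' := by simp
      map_mul' f f' := by simp [zpow_add, Finset.prod_mul_distrib] }
  map_one' := by
    refine MonoidHom.ext fun f => ?_
    simp
  map_mul' a b := by
    refine MonoidHom.ext fun f => ?_
    simp [mul_zpow, Finset.prod_mul_distrib]

theorem evalChar_galAct {R : Type} [CommRing R] [Algebra ℚ R] (a : (K ⊗[ℚ] R)ˣ)
    (σ : QBar ≃ₐ[ℚ] QBar) (f : (K →ₐ[ℚ] QBar) → ℤ) :
    evalChar K R a (Multiplicative.ofAdd (galAct K σ f)) =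
      galUnits R σ (evalChar K R a (Multiplicative.ofAdd f)) := by
  change ∏ ρ, embUnits K ρ a ^ f ((σ.symm : QBar →ₐ[ℚ] QBar).comp ρ) =
    galUnits R σ (∏ ρ, embUnits K ρ a ^ f ρ)
  simp only [map_prod, map_zpow, galUnits_embUnits]
  refine Fintype.prod_equiv (AlgEquiv.arrowCongr AlgEquiv.refl σ.symm) _ _ fun ρ => ?_
  have h1 : (σ : QBar →ₐ[ℚ] QBar).comp (AlgEquiv.arrowCongr AlgEquiv.refl σ.symm ρ) = ρ := by
    ext x
    exact σ.apply_symm_apply (ρ x)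
  have h2 : AlgEquiv.arrowCongr AlgEquiv.refl σ.symm ρ =
      (σ.symm : QBar →ₐ[ℚ] QBar).comp ρ := by
    ext x
    rfl
  rw [h1, h2]

theorem evalChar_map {R S : Type} [CommRing R] [CommRing S] [Algebra ℚ R] [Algebra ℚ S]
    (g : R →ₐ[ℚ] S) (a : (K ⊗[ℚ] R)ˣ) (f : Multiplicative ((K →ₐ[ℚ] QBar) → ℤ)) :
    evalChar K S (Units.map (Algebra.TensorProduct.map (AlgHom.id ℚ K) g : _ →* _) a) f =
      qbarUnitsMap g (evalChar K R a f) := by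
  change ∏ ρ, embUnits K ρ (Units.map _ a) ^ f.toAdd ρ =
    qbarUnitsMap g (∏ ρ, embUnits K ρ a ^ f.toAdd ρ)
  simp only [qbarUnitsMap_embUnits, map_prod, map_zpow]

/-- The quotient map `π^K : T^K → S^K`; it corresponds to the inclusion
`X^*(S^K) ⊆ X^*(T^K)` of character groups. -/
def serreQuotient : torus K ⟶ serreGroup K where
  app R := GrpCat.ofHom
    { toFun a := ⟨(evalChar K R a).comp (AddMonoidHom.toMultiplicative (serreLattice K).subtype),
        fun σ m => evalChar_galAct K _ σ m⟩
      map_one' := Subtype.ext (MonoidHom.ext fun m =>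
        DFunLike.congr_fun (map_one (evalChar K R)) _)
      map_mul' a b := Subtype.ext (MonoidHom.ext fun m =>
        DFunLike.congr_fun (map_mul (evalChar K R) _ _) _) }
  naturality R S g := by
    refine GrpCat.hom_ext (MonoidHom.ext fun a => Subtype.ext (MonoidHom.ext fun m => ?_))
    exact evalChar_map K g.hom _ _

/-- The cocharacter `μ^K = π^K ∘ μ_τ` of `S^K`, where `μ_τ` is dual to the coordinate at `τ`. -/
def serreCochar (τ : K →ₐ[ℚ] QBar) : extendScalars QBar Gm ⟶ extendScalars QBar (serreGroup K) :=
  muPhi K {τ} ≫ extendScalarsMap QBar (serreQuotient K)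

variable {K}

/-- The map `X^*(S^K) → X^*(S^L)`, `f ↦ (ρ ↦ f(ρ|_K))`, for an embedding `j : K → L`. -/
def serreLatticeMap {L : Type} [Field L] [NumberField L] (j : K →ₐ[ℚ] L) :
    serreLattice K →+ serreLattice L where
  toFun f := ⟨fun ρ => (f : (K →ₐ[ℚ] QBar) → ℤ) (ρ.comp j), fun σ => by
    obtain ⟨a, b⟩ := f.2 σ
    exact ⟨funext fun ρ => congrFun a (ρ.comp j), funext fun ρ => congrFun b (ρ.comp j)⟩⟩
  map_zero' := rfl
  map_add' _ _ := rfl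

/-- The norm map `N_{L/K} : S^L → S^K`; it is induced by the norm map `T^L → T^K`, which on
characters is `f ↦ (ρ ↦ f(ρ|_K))`. -/
def serreNorm {L : Type} [Field L] [NumberField L] (j : K →ₐ[ℚ] L) :
    serreGroup L ⟶ serreGroup K where
  app _ := GrpCat.ofHom
    { toFun χ := ⟨χ.1.comp (AddMonoidHom.toMultiplicative (serreLatticeMap j)),
        fun σ m => χ.2 σ (serreLatticeMap j m)⟩
      map_one' := rfl
      map_mul' _ _ := rfl }
  naturality _ _ _ := rfl

end Serre

/-! ### Norms -/

section Norm

variable {K : Type} [Field K] [NumberField K]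

/-- Multiplication by an element of `A ⊗ K` as a matrix over `A`. -/
def mulMatrix {n : Type} [Fintype n] [DecidableEq n] (b : Module.Basis n ℚ K)
    (A : Type) [CommRing A] [Algebra ℚ A] : A ⊗[ℚ] K →ₐ[A] Matrix n n A :=
  Algebra.TensorProduct.lift (Algebra.ofId A _)
    (((Algebra.ofId ℚ A).mapMatrix).comp (Algebra.leftMulMatrix b))
    fun x _ => Algebra.commutes x _

theorem mulMatrix_tmul {n : Type} [Fintype n] [DecidableEq n] (b : Module.Basis n ℚ K)
    {A : Type} [CommRing A] [Algebra ℚ A] (a : A) (k : K) (i j : n) :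
    mulMatrix b A (a ⊗ₜ k) i j = a * algebraMap ℚ A (b.repr (k * b j) i) := by
  have h : mulMatrix b A (a ⊗ₜ k) =
      algebraMap A (Matrix n n A) a * (Algebra.ofId ℚ A).mapMatrix (Algebra.leftMulMatrix b k) :=
    rfl
  rw [h, Matrix.algebraMap_eq_diagonal, Matrix.diagonal_mul, AlgHom.mapMatrix_apply,
    Matrix.map_apply, Algebra.leftMulMatrix_eq_repr_mul]
  rfl

theorem norm_eq_det_mulMatrix {n : Type} [Fintype n] [DecidableEq n] (b : Module.Basis n ℚ K)
    (A : Type) [CommRing A] [Algebra ℚ A] (x : A ⊗[ℚ] K) :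
    Algebra.norm A x = (mulMatrix b A x).det := by
  rw [Algebra.norm_eq_matrix_det (b.baseChange A)]
  congr 1
  have : (Algebra.leftMulMatrix (b.baseChange A)) = mulMatrix b A := by
    apply Algebra.TensorProduct.ext
    · ext
    · ext x i j
      refine Eq.trans ?_ (mulMatrix_tmul b 1 x i j).symm
      simp [Algebra.leftMulMatrix_eq_repr_mul, Algebra.smul_def]
  rw [this]

theorem norm_tensor_map {A B : Type} [CommRing A] [CommRing B] [Algebra ℚ A] [Algebra ℚ B]
    (g : A →ₐ[ℚ] B) (x : A ⊗[ℚ] K) :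
    Algebra.norm B (Algebra.TensorProduct.map g (AlgHom.id ℚ K) x) = g (Algebra.norm A x) := by
  let b := Module.finBasis ℚ K
  rw [norm_eq_det_mulMatrix b, norm_eq_det_mulMatrix b, AlgHom.map_det]
  congr 1
  induction x with
  | zero => simp
  | add x y hx hy => simp only [map_add, hx, hy]
  | tmul a k =>
    ext i j
    rw [Algebra.TensorProduct.map_tmul]
    refine (mulMatrix_tmul b _ _ i j).trans ?_
    change _ = g (mulMatrix b A (a ⊗ₜ k) i j)
    rw [mulMatrix_tmul, map_mul g, AlgHom.commutes]
    rfl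

variable (K)

/-- The isomorphism `E ⊗ (K ⊗ R) ≃ (E ⊗ R) ⊗ K`. -/
def swapEquiv (E R : Type) [CommRing E] [Algebra ℚ E] [CommRing R] [Algebra ℚ R] :
    E ⊗[ℚ] (K ⊗[ℚ] R) ≃ₐ[ℚ] (E ⊗[ℚ] R) ⊗[ℚ] K :=
  (Algebra.TensorProduct.congr AlgEquiv.refl (Algebra.TensorProduct.comm ℚ K R)).trans
    (Algebra.TensorProduct.assoc ℚ ℚ ℚ E R K).symm

/-- The norm `E ⊗ (K ⊗ R) → E ⊗ R` of the finite free algebra `E ⊗ (K ⊗ R)` over `E ⊗ R`. -/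
def relNorm (E R : Type) [CommRing E] [Algebra ℚ E] [CommRing R] [Algebra ℚ R] :
    E ⊗[ℚ] (K ⊗[ℚ] R) →* E ⊗[ℚ] R :=
  (Algebra.norm (E ⊗[ℚ] R) (S := (E ⊗[ℚ] R) ⊗[ℚ] K)).comp
    (swapEquiv K E R).toMulEquiv.toMonoidHom

theorem relNorm_map {E E' R R' : Type} [CommRing E] [Algebra ℚ E] [CommRing R] [Algebra ℚ R]
    [CommRing E'] [Algebra ℚ E'] [CommRing R'] [Algebra ℚ R'] (c : E →ₐ[ℚ] E') (g : R →ₐ[ℚ] R')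
    (x : E ⊗[ℚ] (K ⊗[ℚ] R)) :
    relNorm K E' R' (Algebra.TensorProduct.map c
      (Algebra.TensorProduct.map (AlgHom.id ℚ K) g) x) =
      Algebra.TensorProduct.map c g (relNorm K E R x) := by
  change Algebra.norm (E' ⊗[ℚ] R') (swapEquiv K E' R' _) =
    Algebra.TensorProduct.map c g (Algebra.norm (E ⊗[ℚ] R) (swapEquiv K E R x))
  rw [← norm_tensor_map]
  congr 1
  have : (swapEquiv K E' R' : _ →ₐ[ℚ] _).comp (Algebra.TensorProduct.map c
        (Algebra.TensorProduct.map (AlgHom.id ℚ K) g)) =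
      (Algebra.TensorProduct.map (Algebra.TensorProduct.map c g) (AlgHom.id ℚ K)).comp
        (swapEquiv K E R : _ →ₐ[ℚ] _) := by
    apply Algebra.TensorProduct.ext
    · ext x
      simp [swapEquiv, Algebra.TensorProduct.one_def]
    · apply Algebra.TensorProduct.ext
      · ext x
        simp [swapEquiv]
      · ext x
        simp [swapEquiv]
  exact DFunLike.congr_fun this x

theorem relNorm_one_tmul {E R : Type} [CommRing E] [Algebra ℚ E] [CommRing R] [Algebra ℚ R]
    (x : K ⊗[ℚ] R) :
    relNorm K E R (1 ⊗ₜ x) = 1 ⊗ₜ Algebra.norm R (Algebra.TensorProduct.comm ℚ K R x) := by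
  change Algebra.norm (E ⊗[ℚ] R) (swapEquiv K E R (1 ⊗ₜ x)) =
    (Algebra.TensorProduct.includeRight : R →ₐ[ℚ] E ⊗[ℚ] R) _
  rw [← norm_tensor_map]
  rfl

end Norm

/-! ### The torus `𝒯` -/

section CalT

variable {r : ℕ} (E : Fin r → Type) [∀ i, Field (E i)] [∀ i, NumberField (E i)]
  [∀ i, NumberField.IsCMField (E i)]

/-- The points of `𝒯`: families `(x_i)` with `x_i ∈ (E_i ⊗ R)ˣ` for which there is one
`ν ∈ Rˣ` such that `x_i x_i^ι = ν` for all `i`. -/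
def calTPoints (R : Type) [CommRing R] [Algebra ℚ R] : Subgroup (Π i, (E i ⊗[ℚ] R)ˣ) where
  carrier := {x | ∃ ν : Rˣ, ∀ i, (x i : E i ⊗[ℚ] R) *
    Algebra.TensorProduct.map (conjCM (E i)) (AlgHom.id ℚ R) (x i : E i ⊗[ℚ] R) = 1 ⊗ₜ (ν : R)}
  one_mem' := ⟨1, fun i => by simp [Algebra.TensorProduct.one_def]⟩
  mul_mem' := by
    rintro x y ⟨ν, hν⟩ ⟨ν', hν'⟩
    refine ⟨ν * ν', fun i => ?_⟩
    rw [Pi.mul_apply, Units.val_mul, map_mul, mul_mul_mul_comm, hν, hν',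
      Algebra.TensorProduct.tmul_mul_tmul, one_mul, Units.val_mul]
  inv_mem' := by
    rintro x ⟨ν, hν⟩
    refine ⟨ν⁻¹, fun i => ?_⟩
    have h1 := congrArg (fun z => (((x i)⁻¹ : (E i ⊗[ℚ] R)ˣ) : E i ⊗[ℚ] R) *
      Algebra.TensorProduct.map (conjCM (E i)) (AlgHom.id ℚ R)
        (((x i)⁻¹ : (E i ⊗[ℚ] R)ˣ) : E i ⊗[ℚ] R) * (z * (1 ⊗ₜ ((ν⁻¹ : Rˣ) : R)))) (hν i)
    simp only [Algebra.TensorProduct.tmul_mul_tmul, one_mul, Units.mul_inv] at h1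
    rw [← mul_assoc, mul_mul_mul_comm, Units.inv_mul, ← map_mul, Units.inv_mul, map_one, one_mul,
      one_mul, ← Algebra.TensorProduct.one_def, mul_one] at h1
    exact h1.symm

variable {E} in
theorem calTPoints_map {R S : Type} [CommRing R] [Algebra ℚ R] [CommRing S] [Algebra ℚ S]
    (g : R →ₐ[ℚ] S) {x : Π i, (E i ⊗[ℚ] R)ˣ} (hx : x ∈ calTPoints E R) :
    (fun i => Units.map (Algebra.TensorProduct.map (AlgHom.id ℚ (E i)) g : _ →* _) (x i)) ∈
      calTPoints E S := by
  obtain ⟨ν, hν⟩ := hx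
  refine ⟨Units.map (g : R →* S) ν, fun i => ?_⟩
  have h := congrArg (Algebra.TensorProduct.map (AlgHom.id ℚ (E i)) g) (hν i)
  rw [map_mul, Algebra.TensorProduct.map_tmul, map_one] at h
  refine Eq.trans ?_ h
  change Algebra.TensorProduct.map (AlgHom.id ℚ (E i)) g (x i : E i ⊗[ℚ] R) *
    Algebra.TensorProduct.map (conjCM (E i)) (AlgHom.id ℚ S)
      (Algebra.TensorProduct.map (AlgHom.id ℚ (E i)) g (x i : E i ⊗[ℚ] R)) = _
  congr 1
  rw [← AlgHom.comp_apply, ← AlgHom.comp_apply, ← Algebra.TensorProduct.map_comp,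
    ← Algebra.TensorProduct.map_comp]
  rfl

/-- The torus `𝒯` of all `(x_i) ∈ ∏ T^{E_i}` such that the `x_i x_i^ι` are one and the same
scalar. -/
def calT : QGroup where
  obj R := GrpCat.of (calTPoints E R)
  map {R S} g := GrpCat.ofHom
    { toFun x := ⟨_, calTPoints_map g.hom x.2⟩
      map_one' := Subtype.ext (funext fun i => map_one _)
      map_mul' x y := Subtype.ext (funext fun i => map_mul _ _ _) }
  map_id R := by
    refine GrpCat.hom_ext (MonoidHom.ext fun x => Subtype.ext (funext fun i => Units.ext ?_))
    change Algebra.TensorProduct.map (AlgHom.id ℚ (E i)) (AlgHom.id ℚ R) _ = _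
    rw [Algebra.TensorProduct.map_id]
    rfl
  map_comp f g := by
    refine GrpCat.hom_ext (MonoidHom.ext fun x => Subtype.ext (funext fun i => Units.ext ?_))
    change Algebra.TensorProduct.map (AlgHom.id ℚ (E i)) (g.hom.comp f.hom) _ =
      Algebra.TensorProduct.map (AlgHom.id ℚ (E i)) g.hom
        (Algebra.TensorProduct.map (AlgHom.id ℚ (E i)) f.hom _)
    rw [← AlgHom.comp_apply, ← Algebra.TensorProduct.map_comp]
    rfl

/-- The projection `𝒯 → T^{E_i}`. -/
def calTProj (i : Fin r) : calT E ⟶ torus (E i) where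
  app _ := GrpCat.ofHom
    { toFun x := x.1 i
      map_one' := rfl
      map_mul' _ _ := rfl }
  naturality _ _ _ := rfl

variable {E} in
theorem calTPoints_norm (K : Type) [Field K] [NumberField K] {R : Type} [CommRing R] [Algebra ℚ R]
    {x : Π i, (E i ⊗[ℚ] (K ⊗[ℚ] R))ˣ} (hx : x ∈ calTPoints E (K ⊗[ℚ] R)) :
    (fun i => Units.map (relNorm K (E i) R) (x i)) ∈ calTPoints E R := by
  obtain ⟨ν, hν⟩ := hx
  refine ⟨Units.map ((Algebra.norm R (S := R ⊗[ℚ] K)).comp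
    (Algebra.TensorProduct.comm ℚ K R).toMulEquiv.toMonoidHom) ν, fun i => ?_⟩
  refine Eq.trans ?_ (relNorm_one_tmul K (E := E i) (ν : K ⊗[ℚ] R))
  rw [← hν i, map_mul, Units.coe_map]
  congr 1
  rw [← relNorm_map, Algebra.TensorProduct.map_id]

/-- The norm map `Nm_{K/ℚ} : Res_{K/ℚ}(𝒯_K) → 𝒯`. -/
def calTNorm (K : Type) [Field K] [NumberField K] :
    weilRestriction K (extendScalars K (calT E)) ⟶ calT E where
  app R := GrpCat.ofHom
    { toFun (x : calTPoints E (K ⊗[ℚ] R)) := (⟨_, calTPoints_norm K x.2⟩ : calTPoints E R)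
      map_one' := Subtype.ext (funext fun i => map_one _)
      map_mul' x y := Subtype.ext (funext fun i => map_mul (Units.map (relNorm K (E i) R)) _ _) }
  naturality R S g := by
    refine GrpCat.hom_ext (MonoidHom.ext fun x => Subtype.ext (funext fun i => Units.ext ?_))
    exact relNorm_map K (AlgHom.id ℚ (E i)) g.hom _

end CalT

/-! ### The symplectic space and its group of similitudes -/

section GSp

section General

variable (V : Type) [AddCommGroup V] [Module ℚ V]

/-- The map `End_R(R ⊗ V) → End_S(S ⊗ V)` of a homomorphism `R → S`. -/
def endMap {R S : Type} [CommRing R] [Algebra ℚ R] [CommRing S] [Algebra ℚ S] (g : R →ₐ[ℚ] S)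
    (f : Module.End R (R ⊗[ℚ] V)) : Module.End S (S ⊗[ℚ] V) :=
  LinearMap.liftBaseChange S
    (g.toLinearMap.rTensor V ∘ₗ f.restrictScalars ℚ ∘ₗ TensorProduct.mk ℚ R V 1)

theorem endMap_apply {R S : Type} [CommRing R] [Algebra ℚ R] [CommRing S] [Algebra ℚ S]
    (g : R →ₐ[ℚ] S) (f : Module.End R (R ⊗[ℚ] V)) (x : R ⊗[ℚ] V) :
    endMap V g f (g.toLinearMap.rTensor V x) = g.toLinearMap.rTensor V (f x) := by
  have hs : ∀ (a : R) (y : R ⊗[ℚ] V),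
      g.toLinearMap.rTensor V (a • y) = g a • g.toLinearMap.rTensor V y := by
    intro a y
    induction y with
    | zero => simp
    | add x y hx hy => simp only [smul_add, map_add, hx, hy]
    | tmul b v => simp [TensorProduct.smul_tmul']
  induction x with
  | zero => simp
  | add x y hx hy => simp only [map_add, hx, hy]
  | tmul a v =>
    have : a ⊗ₜ[ℚ] v = a • (1 ⊗ₜ[ℚ] v : R ⊗[ℚ] V) := by simp [TensorProduct.smul_tmul']
    rw [this, hs, map_smul, map_smul, hs]
    simp [endMap]

/-- `endMap` as a homomorphism of monoids. -/
def endMapHom {R S : Type} [CommRing R] [Algebra ℚ R] [CommRing S] [Algebra ℚ S]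
    (g : R →ₐ[ℚ] S) : Module.End R (R ⊗[ℚ] V) →* Module.End S (S ⊗[ℚ] V) where
  toFun := endMap V g
  map_one' := by ext; simp [endMap]
  map_mul' f f' := by
    ext v
    have h : ∀ f, endMap V g f (1 ⊗ₜ v) = g.toLinearMap.rTensor V (f (1 ⊗ₜ v)) := fun f => by
      simp [endMap]
    simp [h, endMap_apply]

variable {V} (ψ : LinearMap.BilinForm ℚ V)

theorem baseChange_rTensor {R S : Type} [CommRing R] [Algebra ℚ R] [CommRing S] [Algebra ℚ S]
    (g : R →ₐ[ℚ] S) (x y : R ⊗[ℚ] V) :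
    ψ.baseChange S (g.toLinearMap.rTensor V x) (g.toLinearMap.rTensor V y) =
      g (ψ.baseChange R x y) := by
  induction x with
  | zero => simp
  | add x x' hx hx' => simp only [map_add, LinearMap.add_apply, hx, hx']
  | tmul a v =>
    induction y with
    | zero => simp
    | add x x' hx hx' => simp only [map_add, hx, hx']
    | tmul b w => simp

/-- The points of `GSp(V, ψ)`: the `R`-linear automorphisms `f` of `R ⊗ V` for which there is
`ν ∈ Rˣ` with `ψ_R(f x, f y) = ν ψ_R(x, y)`. -/
def gspPoints (R : Type) [CommRing R] [Algebra ℚ R] : Subgroup (Module.End R (R ⊗[ℚ] V))ˣ where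
  carrier := {f | ∃ ν : Rˣ, ∀ x y, ψ.baseChange R (f.1 x) (f.1 y) = ν * ψ.baseChange R x y}
  one_mem' := ⟨1, fun x y => by simp⟩
  mul_mem' := by
    rintro f f' ⟨ν, h⟩ ⟨ν', h'⟩
    exact ⟨ν * ν', fun x y => by simp [h, h', mul_assoc]⟩
  inv_mem' := by
    rintro f ⟨ν, h⟩
    refine ⟨ν⁻¹, fun x y => ?_⟩
    have hf : ∀ z, f.1 ((f⁻¹).1 z) = z := fun z => by
      rw [← Module.End.mul_apply, Units.mul_inv]
      rfl
    have := h ((f⁻¹).1 x) ((f⁻¹).1 y)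
    rw [hf, hf] at this
    rw [this, Units.inv_mul_cancel_left]

theorem gspPoints_map {R S : Type} [CommRing R] [Algebra ℚ R] [CommRing S] [Algebra ℚ S]
    (g : R →ₐ[ℚ] S) {f : (Module.End R (R ⊗[ℚ] V))ˣ} (hf : f ∈ gspPoints ψ R) :
    Units.map (endMapHom V g) f ∈ gspPoints ψ S := by
  obtain ⟨ν, h⟩ := hf
  refine ⟨Units.map (g : R →* S) ν, fun x y => ?_⟩
  change ψ.baseChange S (endMap V g f.1 x) (endMap V g f.1 y) = g ν * ψ.baseChange S x y
  have h1 : ∀ (s : S) (v : V), s ⊗ₜ[ℚ] v = s • g.toLinearMap.rTensor V (1 ⊗ₜ[ℚ] v) := by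
    intro s v
    simp [TensorProduct.smul_tmul']
  induction x with
  | zero => simp
  | add x x' hx hx' => simp only [map_add, LinearMap.add_apply, hx, hx', mul_add]
  | tmul a v =>
    induction y with
    | zero => simp
    | add x x' hx hx' => simp only [map_add, hx, hx', mul_add]
    | tmul b w =>
      rw [h1, h1]
      simp only [map_smul, LinearMap.smul_apply, endMap_apply, baseChange_rTensor, h, map_mul,
        smul_eq_mul]
      ring

/-- The group of symplectic similitudes `GSp(V, ψ)`. -/
def GSp : QGroup where
  obj R := GrpCat.of (gspPoints ψ R)
  map {R S} g := GrpCat.ofHom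
    { toFun f := ⟨_, gspPoints_map ψ g.hom f.2⟩
      map_one' := Subtype.ext (map_one _)
      map_mul' _ _ := Subtype.ext (map_mul _ _ _) }
  map_id R := by
    refine GrpCat.hom_ext (MonoidHom.ext fun f => Subtype.ext (Units.ext ?_))
    refine LinearMap.ext fun x => ?_
    have := endMap_apply V (AlgHom.id ℚ R) f.1.1 x
    have h : (AlgHom.id ℚ R).toLinearMap.rTensor V = LinearMap.id := LinearMap.rTensor_id V R
    rw [h] at this
    exact this
  map_comp {R S T} f g := by
    refine GrpCat.hom_ext (MonoidHom.ext fun F => Subtype.ext (Units.ext ?_))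
    refine TensorProduct.AlgebraTensorModule.curry_injective (LinearMap.ext_ring ?_)
    refine LinearMap.ext fun v => ?_
    change endMap V (g.hom.comp f.hom) F.1.1 (1 ⊗ₜ v) =
      endMap V g.hom (endMap V f.hom F.1.1) (1 ⊗ₜ v)
    have h1 : (1 ⊗ₜ[ℚ] v : T ⊗[ℚ] V) = (g.hom.comp f.hom).toLinearMap.rTensor V (1 ⊗ₜ v) := by simp
    have h2 : (1 ⊗ₜ[ℚ] v : T ⊗[ℚ] V) =
        g.hom.toLinearMap.rTensor V (f.hom.toLinearMap.rTensor V (1 ⊗ₜ v)) := by simp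
    conv_lhs => rw [h1]
    conv_rhs => rw [h2]
    rw [endMap_apply, endMap_apply, endMap_apply, AlgHom.comp_toLinearMap,
      LinearMap.rTensor_comp]
    rfl

end General

variable {r : ℕ} {E : Fin r → Type} [∀ i, Field (E i)] [∀ i, NumberField (E i)]
  [∀ i, NumberField.IsCMField (E i)]

/-- The form `ψ_i(x, y) = Tr_{E/ℚ}(ξ x y^ι)` on a CM field `E`. -/
def psiCM (E : Type) [Field E] [NumberField E] [NumberField.IsCMField E] (ξ : E) :
    LinearMap.BilinForm ℚ E :=
  (Algebra.traceForm ℚ E).comp (LinearMap.mulLeft ℚ ξ) (conjCM E).toLinearMap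

theorem psiCM_apply (E : Type) [Field E] [NumberField E] [NumberField.IsCMField E] (ξ x y : E) :
    psiCM E ξ x y = Algebra.trace ℚ E (ξ * x * conjCM E y) := rfl

/-- The form `ψ_E`, the orthogonal sum of the forms `ψ_i` on `V_E = ⨁ E_i`. -/
def psiE (ξ : Π i, E i) : LinearMap.BilinForm ℚ (Π i, E i) :=
  ∑ i, (psiCM (E i) (ξ i)).comp (LinearMap.proj i) (LinearMap.proj i)

variable (E) in
/-- Complex conjugation on the algebra `∏ E_i`. -/
def conjPi : (Π i, E i) →ₐ[ℚ] (Π i, E i) :=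
  AlgHom.pi fun i => (conjCM (E i)).comp (Pi.evalAlgHom ℚ E i)

variable (E) in
/-- Complex conjugation on `R ⊗ ∏ E_i`. -/
def conjPiTensor (R : Type) [CommRing R] [Algebra ℚ R] :
    R ⊗[ℚ] (Π i, E i) →ₐ[R] R ⊗[ℚ] (Π i, E i) :=
  Algebra.TensorProduct.map (AlgHom.id R R) (conjPi E)

/-- The linear form `b ↦ ∑ Tr(ξ_i b_i)`. -/
def tracePi (ξ : Π i, E i) : (Π i, E i) →ₗ[ℚ] ℚ :=
  ∑ i, Algebra.trace ℚ (E i) ∘ₗ LinearMap.mulLeft ℚ (ξ i) ∘ₗ LinearMap.proj i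

theorem psiE_eq (ξ : Π i, E i) (x y : Π i, E i) :
    psiE ξ x y = tracePi ξ (x * conjPi E y) := by
  simp [psiE, tracePi, psiCM_apply, conjPi, mul_assoc]

theorem psiE_baseChange_eq (ξ : Π i, E i) {R : Type} [CommRing R] [Algebra ℚ R]
    (x y : R ⊗[ℚ] (Π i, E i)) :
    (psiE ξ).baseChange R x y = LinearMap.liftBaseChange R (Algebra.linearMap ℚ R ∘ₗ tracePi ξ)
      (x * conjPiTensor E R y) := by
  induction x with
  | zero => simp
  | add x x' hx hx' => simp only [map_add, LinearMap.add_apply, hx, hx', add_mul]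
  | tmul a v =>
    induction y with
    | zero => simp
    | add x x' hx hx' => simp only [map_add, hx, hx', mul_add]
    | tmul b w => simp [conjPiTensor, psiE_eq, Algebra.smul_def, mul_comm]

variable (E) in
/-- The isomorphism `∏ (E_i ⊗ R) ≃ R ⊗ ∏ E_i`. -/
def piTensorEquiv (R : Type) [CommRing R] [Algebra ℚ R] :
    (Π i, E i ⊗[ℚ] R) ≃ₐ[ℚ] R ⊗[ℚ] (Π i, E i) :=
  (AlgEquiv.piCongrRight fun i => Algebra.TensorProduct.comm ℚ (E i) R).trans
    (Algebra.TensorProduct.piRight ℚ ℚ R E).symm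

theorem piRight_map {R S : Type} [CommRing R] [Algebra ℚ R] [CommRing S] [Algebra ℚ S]
    (g : R →ₐ[ℚ] S) (y : R ⊗[ℚ] (Π i, E i)) (i : Fin r) :
    Algebra.TensorProduct.piRight ℚ ℚ S E (Algebra.TensorProduct.map g (AlgHom.id ℚ _) y) i =
      Algebra.TensorProduct.map g (AlgHom.id ℚ _) (Algebra.TensorProduct.piRight ℚ ℚ R E y i) := by
  induction y with
  | zero => simp
  | add x y hx hy => simp only [map_add, Pi.add_apply, hx, hy]
  | tmul a v => simp

theorem piRight_conj {R : Type} [CommRing R] [Algebra ℚ R]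
    (y : R ⊗[ℚ] (Π i, E i)) (i : Fin r) :
    Algebra.TensorProduct.piRight ℚ ℚ R E
        (conjPiTensor E R y) i =
      Algebra.TensorProduct.map (AlgHom.id R R) (conjCM (E i))
        (Algebra.TensorProduct.piRight ℚ ℚ R E y i) := by
  induction y with
  | zero => simp
  | add x y hx hy => simp only [map_add, Pi.add_apply, hx, hy]
  | tmul a v => simp [conjPiTensor, conjPi]

theorem piRight_piTensorEquiv {R : Type} [CommRing R] [Algebra ℚ R] (x : Π i, E i ⊗[ℚ] R)
    (i : Fin r) : Algebra.TensorProduct.piRight ℚ ℚ R E (piTensorEquiv E R x) i =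
      Algebra.TensorProduct.comm ℚ (E i) R (x i) := by
  change Algebra.TensorProduct.piRight ℚ ℚ R E
    ((Algebra.TensorProduct.piRight ℚ ℚ R E).symm _) i = _
  rw [AlgEquiv.apply_symm_apply]
  rfl

theorem piTensorEquiv_map {R S : Type} [CommRing R] [Algebra ℚ R] [CommRing S] [Algebra ℚ S]
    (g : R →ₐ[ℚ] S) (x : Π i, E i ⊗[ℚ] R) :
    piTensorEquiv E S (fun i => Algebra.TensorProduct.map (AlgHom.id ℚ (E i)) g (x i)) =
      Algebra.TensorProduct.map g (AlgHom.id ℚ _) (piTensorEquiv E R x) := by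
  apply (Algebra.TensorProduct.piRight ℚ ℚ S E).injective
  funext i
  rw [piRight_map, piRight_piTensorEquiv, piRight_piTensorEquiv]
  generalize x i = z
  induction z with
  | zero => simp
  | add x y hx hy => simp only [map_add, hx, hy]
  | tmul a b => simp

variable (E) in
/-- The action of `∏ (E_i ⊗ R)ˣ` on `R ⊗ V_E ≃ ∏ (E_i ⊗ R)` by multiplication. -/
def diagAction (R : Type) [CommRing R] [Algebra ℚ R] :
    (Π i, (E i ⊗[ℚ] R)ˣ) →* (Module.End R (R ⊗[ℚ] (Π i, E i)))ˣ :=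
  (Units.map ((Algebra.lmul R (R ⊗[ℚ] (Π i, E i)) : _ →* _).comp
    (piTensorEquiv E R).toMulEquiv.toMonoidHom)).comp
    (MulEquiv.piUnits (M := fun i => E i ⊗[ℚ] R)).symm.toMonoidHom

theorem diagAction_apply {R : Type} [CommRing R] [Algebra ℚ R] (x : Π i, (E i ⊗[ℚ] R)ˣ)
    (y : R ⊗[ℚ] (Π i, E i)) :
    (diagAction E R x).1 y = piTensorEquiv E R (fun i => (x i : E i ⊗[ℚ] R)) * y := rfl

theorem diagAction_mem (ξ : Π i, E i) {R : Type} [CommRing R] [Algebra ℚ R]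
    {x : Π i, (E i ⊗[ℚ] R)ˣ} (hx : x ∈ calTPoints E R) :
    diagAction E R x ∈ gspPoints (psiE ξ) R := by
  obtain ⟨ν, hν⟩ := hx
  refine ⟨ν, fun u v => ?_⟩
  rw [diagAction_apply, diagAction_apply, psiE_baseChange_eq, psiE_baseChange_eq]
  set X := piTensorEquiv E R (fun i => (x i : E i ⊗[ℚ] R)) with hX
  have key : X * conjPiTensor E R X =
      (ν : R) ⊗ₜ[ℚ] (1 : Π i, E i) := by
    refine (Algebra.TensorProduct.piRight ℚ ℚ R E).injective (funext fun i => ?_)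
    rw [map_mul, Pi.mul_apply, piRight_conj, hX, piRight_piTensorEquiv]
    have h1 : Algebra.TensorProduct.piRight ℚ ℚ R E ((ν : R) ⊗ₜ[ℚ] (1 : Π i, E i)) i =
        Algebra.TensorProduct.comm ℚ (E i) R (1 ⊗ₜ (ν : R)) := by
      simp
    have h2 : ∀ z : E i ⊗[ℚ] R, Algebra.TensorProduct.map (AlgHom.id R R) (conjCM (E i))
        (Algebra.TensorProduct.comm ℚ (E i) R z) = Algebra.TensorProduct.comm ℚ (E i) R
          (Algebra.TensorProduct.map (conjCM (E i)) (AlgHom.id ℚ R) z) := by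
      intro z
      induction z with
      | zero => simp
      | add x y hx hy => simp only [map_add, hx, hy]
      | tmul a b => simp
    rw [h1, h2, ← map_mul, hν i]
  have h3 : (ν : R) ⊗ₜ[ℚ] (1 : Π i, E i) = (ν : R) • (1 : R ⊗[ℚ] (Π i, E i)) := by
    rw [Algebra.TensorProduct.one_def, TensorProduct.smul_tmul', smul_eq_mul, mul_one]
  have h4 : X * u * (conjPiTensor E R X * conjPiTensor E R v) =
      X * conjPiTensor E R X * (u * conjPiTensor E R v) :=
    mul_mul_mul_comm (G := R ⊗[ℚ] (Π i, E i)) _ _ _ _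
  rw [map_mul (conjPiTensor E R), h4, key, h3, smul_mul_assoc, one_mul, map_smul, smul_eq_mul]

/-- The inclusion `𝔦 : 𝒯 → GSp(V_E, ψ_E)`. -/
def calTToGSp (ξ : Π i, E i) : calT E ⟶ GSp (psiE ξ) where
  app R := GrpCat.ofHom
    { toFun x := ⟨_, diagAction_mem ξ x.2⟩
      map_one' := Subtype.ext (map_one (diagAction E R))
      map_mul' x y := Subtype.ext (map_mul (diagAction E R) _ _) }
  naturality R S g := by
    refine GrpCat.hom_ext (MonoidHom.ext fun (x : calTPoints E R) => Subtype.ext (Units.ext ?_))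
    refine TensorProduct.AlgebraTensorModule.curry_injective (LinearMap.ext_ring ?_)
    refine LinearMap.ext fun v => ?_
    change piTensorEquiv E S (fun i => Algebra.TensorProduct.map (AlgHom.id ℚ (E i)) g.hom
        (x.1 i : E i ⊗[ℚ] R)) * (1 ⊗ₜ v) =
      endMap _ g.hom (diagAction E R x.1).1 (1 ⊗ₜ v)
    have h1 : (1 ⊗ₜ[ℚ] v : S ⊗[ℚ] (Π i, E i)) = g.hom.toLinearMap.rTensor _ (1 ⊗ₜ v) := by simp
    have h2 : (1 ⊗ₜ[ℚ] v : S ⊗[ℚ] (Π i, E i)) =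
      Algebra.TensorProduct.map g.hom (AlgHom.id ℚ _) (1 ⊗ₜ v) := by simp
    conv_rhs => rw [h1]
    rw [endMap_apply, piTensorEquiv_map, h2, ← map_mul, diagAction_apply]
    rfl

end GSp

/-! ### The two homomorphisms `T^K → GSp(V_E, ψ_E)` -/

section Main

/-- `ρ : S^{E^*} → T^E` is the homomorphism `ρ_Φ` that the universal property of the Serre group
attaches to `μ_Φ`: it satisfies `μ_Φ = ρ ∘ μ^{E^*}` over `QBar`. -/
def IsRhoPhi {E : Type} [Field E] [NumberField E] (Φ : Set (E →ₐ[ℚ] QBar))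
    (ρ : serreGroup (reflexField Φ) ⟶ torus E) : Prop :=
  muPhi E Φ = serreCochar (reflexField Φ) (reflexField.incl Φ) ≫ extendScalarsMap QBar ρ

variable {K : Type} [Field K] [NumberField K] (τ : K →ₐ[ℚ] QBar) (E : IntermediateField ℚ K)
  {r : ℕ} {Ei : Fin r → Type} [∀ i, Field (Ei i)] [∀ i, NumberField (Ei i)]
  [∀ i, NumberField.IsCMField (Ei i)] (Φ : Π i, Set (Ei i →ₐ[ℚ] QBar))
  (hΦE : ∀ i, reflexField (Φ i) ≤ E.map τ) (ξ : Π i, Ei i)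

/-- `φ` is the composite
`T^K → S^K → S^E → ∏ S^{E_i^*} → ∏ T^{E_i} ⊇ 𝒯 → GSp(V_E, ψ_E)` of `π^K`, `N_{K/E}`,
`∏ N_{E/E_i^*}`, `∏ ρ_{Φ_i}` and `𝔦`; here `f : S^E → 𝒯` is the composite
`∏ ρ_{Φ_i} ∘ N_{E/E_i^*}` with restricted target. -/
def IsVarphi (φ : torus K ⟶ GSp (psiE ξ)) : Prop :=
  ∃ (ρ : Π i, serreGroup (reflexField (Φ i)) ⟶ torus (Ei i)) (f : serreGroup E ⟶ calT Ei),
    (∀ i, IsRhoPhi (Φ i) (ρ i)) ∧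
    (∀ i, f ≫ calTProj Ei i = serreNorm (inclOfLE τ E (reflexField (Φ i)) (hΦE i)) ≫ ρ i) ∧
    φ = serreQuotient K ≫ serreNorm (subfieldIncl E) ≫ f ≫ calTToGSp ξ

/-- The cocharacter `μ` of `𝒯` over `K` becomes `∏ μ_{Φ_i}` over `QBar`, where `K`
lies in `QBar` by means of `τ`. -/
def IsMuCM (μ : extendScalars K Gm ⟶ extendScalars K (calT Ei)) : Prop :=
  ∀ (A : AlgOver QBar) (i : Fin r),
    μ.app ((Under.map (CommAlgCat.ofHom τ)).obj A) ≫ (calTProj Ei i).app A.right =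
      (muPhi (Ei i) (Φ i)).app A

/-- `η` is the composite `T^K → Res_{K/ℚ}(𝒯_K) → 𝒯 → GSp(V_E, ψ_E)` of `Res_{K/ℚ}(μ'_cm)`,
`Nm_{K/ℚ}` and `𝔦`, where `μ'_cm = ∏ μ_{Φ_i}`, as a cocharacter of `𝒯` over `K`. -/
def IsEta (η : torus K ⟶ GSp (psiE ξ)) : Prop :=
  ∃ μ : extendScalars K Gm ⟶ extendScalars K (calT Ei), IsMuCM τ Φ μ ∧
    η = weilRestrictionMap K μ ≫ calTNorm Ei K ≫ calTToGSp ξ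

end Main

end

open CategoryTheory TensorProduct

noncomputable section

/-! ### Galois theory of `QBar` -/

/-! A homomorphism out of `T^K` into a torus `T^L` is determined by its composite with the single
cocharacter `μ_τ` (`torus_hom_ext`). Over a `QBar`-algebra, every point of `T^K` is a product of
values of the cocharacters `μ_κ`; Galois acts transitively on the embeddings `κ`, and twisting the
`QBar`-structure by `σ` turns `μ_κ` into `μ_{σκ}`. Points over a general `R` embed into points over
`QBar ⊗ R`. Since `𝒯` lies in `∏ T^{E_i}`, two homomorphisms `T^K → 𝒯` with the same composites with
`μ_τ` agree (`IsCMHom.unique`).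

Before `𝔦` is applied, both constructions send `μ_τ` to `∏ μ_{Φ_i}`. For `φ`, norms of Serre groups
carry `μ^K` to `μ^L` (`serreCochar_serreNorm`), and `ρ_{Φ_i}` carries `μ^{E_i^*}` to `μ_{Φ_i}`. For
`η`, the norm over a `QBar`-algebra is a product over the embeddings `κ` of `K`, and at `μ_τ(z)`
only the factor `κ = τ` is nontrivial (`isCMHom_of_isMuCM`). Hence `φ = η`.

Existence of `φ` requires `ρ_Φ`. On characters it sends `[ε]` to the indicator, on `Hom(E^*, QBar)`,
of the restrictions of those `σ` with `σ⁻¹ε ∈ Φ`; Dedekind independence makes this well defined, the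
CM condition puts it in the Serre lattice, and Galois descent for `L ⊗ R` turns the character map
into a map on points. The components land in `𝒯` because the characters at `ε` and `ιε` add up to
the constant `1`. Existence of `η` requires `μ'_cm` over `K`: the separability idempotent of `K`
gives a `K`-rational form `muTaut` of `μ_τ`, and composing it with the homomorphism `T^K → 𝒯`
already built gives `μ'_cm`. -/

instance QBar.instIsAlgebraic : Algebra.IsAlgebraic ℚ QBar where
  isAlgebraic x := by
    have h : IsAlgebraic ℚ (QBar.val x) :=
      mem_algebraicClosure_iff.1 (show (x : algebraicClosure ℚ ℂ).1 ∈ _ from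
        (x : algebraicClosure ℚ ℂ).2)
    exact (isAlgebraic_algHom_iff QBar.val.toRatAlgHom QBar.val.injective).1 h

instance QBar.instIsAlgClosure : IsAlgClosure ℚ QBar := ⟨inferInstance, inferInstance⟩

instance QBar.instIsGalois : IsGalois ℚ QBar := IsAlgClosure.isGalois ℚ QBar

section Galois

variable {K : Type} [Field K] [NumberField K]

/-- The images of a primitive element under two embeddings are roots of the same minimal polynomial,
hence Galois conjugate. -/
theorem exists_galois_comp_eq (κ τ : K →ₐ[ℚ] QBar) :
    ∃ σ : QBar ≃ₐ[ℚ] QBar, (σ : QBar →ₐ[ℚ] QBar).comp τ = κ := by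
  let p := Field.powerBasisOfFiniteOfSeparable ℚ K
  obtain ⟨σ, hσ⟩ := minpoly.exists_algEquiv_of_root' (K := ℚ) (L := QBar) (x := κ p.gen)
    (y := τ p.gen) (Algebra.IsAlgebraic.isAlgebraic _) (by
      rw [minpoly.algHom_eq τ τ.injective, Polynomial.aeval_algHom_apply, minpoly.aeval, map_zero])
  exact ⟨σ, p.algHom_ext hσ⟩

theorem mem_range_of_forall_fixed (κ : K →ₐ[ℚ] QBar) {q : QBar}
    (hq : ∀ σ : QBar ≃ₐ[ℚ] QBar, (σ : QBar →ₐ[ℚ] QBar).comp κ = κ → σ q = q) :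
    ∃ k, κ k = q := by
  change q ∈ κ.fieldRange
  rw [← InfiniteGalois.fixedField_fixingSubgroup κ.fieldRange]
  rintro ⟨σ, hσ⟩
  exact hq σ (AlgHom.ext fun k => hσ ⟨κ k, k, rfl⟩)

theorem conjQBar_conjQBar (x : QBar) : conjQBar (conjQBar x) = x := by
  apply QBar.val.injective
  rw [val_conjQBar, val_conjQBar, Complex.conj_conj]

/-- The characteristic property of a CM field. It makes `ι` commute with every `σ` on embeddings of
a CM field. -/
theorem comp_conjCM [NumberField.IsCMField K] (ε : K →ₐ[ℚ] QBar) :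
    ε.comp (conjCM K) = (conjQBar : QBar →ₐ[ℚ] QBar).comp ε := by
  refine AlgHom.ext fun x => QBar.val.injective ?_
  refine Eq.trans ?_ (val_conjQBar (ε x)).symm
  exact NumberField.IsCMField.complexEmbedding_complexConj K
    (QBar.val.comp (ε : K →+* QBar)) x

theorem finsum_mem_comp_eq (Φ : Set (K →ₐ[ℚ] QBar)) (s : QBar ≃ₐ[ℚ] QBar)
    (hs : (s : QBar →ₐ[ℚ] QBar).comp (reflexField.incl Φ) = reflexField.incl Φ) (e : K) :
    s (∑ᶠ φ ∈ Φ, φ e) = ∑ᶠ φ ∈ Φ, φ e :=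
  DFunLike.congr_fun hs ⟨_, IntermediateField.subset_adjoin ℚ _ ⟨e, rfl⟩⟩

/-- Such an `s` fixes all sums `∑_{φ ∈ Φ} φ(e)`, so the sums over `Φ` and over `sΦ` are equal as
functions of `e`. Dedekind's independence of characters then gives `sΦ = Φ`. -/
theorem comp_mem_of_comp_incl_eq (Φ : Set (K →ₐ[ℚ] QBar)) (s : QBar ≃ₐ[ℚ] QBar)
    (hs : (s : QBar →ₐ[ℚ] QBar).comp (reflexField.incl Φ) = reflexField.incl Φ)
    {ε : K →ₐ[ℚ] QBar} (hε : ε ∈ Φ) : (s : QBar →ₐ[ℚ] QBar).comp ε ∈ Φ := by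
  classical
  -- The indicator functions of `Φ` and, for `c'`, of `sΦ`.
  let c : (K →ₐ[ℚ] QBar) → QBar := fun φ => if φ ∈ Φ then 1 else 0
  let c' : (K →ₐ[ℚ] QBar) → QBar :=
    fun φ => if (s.symm : QBar →ₐ[ℚ] QBar).comp φ ∈ Φ then 1 else 0
  have hsum : ∀ e : K, ∑ᶠ φ ∈ Φ, φ e = ∑ φ, c φ * φ e := fun e => by
    rw [finsum_mem_def, finsum_eq_sum_of_fintype]
    refine Finset.sum_congr rfl fun φ _ => ?_
    by_cases h : φ ∈ Φ <;> simp [c, h]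
  have hli := linearIndependent_monoidHom K QBar
  have hli' : LinearIndependent QBar (fun φ : K →ₐ[ℚ] QBar => (φ : K → QBar)) :=
    hli.comp (fun φ : K →ₐ[ℚ] QBar => (φ : K →* QBar)) fun φ φ' h =>
      AlgHom.ext fun x => DFunLike.congr_fun h x
  have hcc : c' = c := by
    have h0 := Fintype.linearIndependent_iff.1 hli' (c' - c) (by
      funext e
      have h1 := finsum_mem_comp_eq Φ s hs e
      rw [hsum, map_sum] at h1
      have h2 : ∑ φ, s (c φ * φ e) = ∑ φ, c' φ * φ e := by
        refine Fintype.sum_equiv (AlgEquiv.arrowCongr AlgEquiv.refl s) _ _ fun φ => ?_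
        have h3 : AlgEquiv.arrowCongr AlgEquiv.refl s φ = (s : QBar →ₐ[ℚ] QBar).comp φ := by
          ext x; rfl
        have h4 : (s.symm : QBar →ₐ[ℚ] QBar).comp ((s : QBar →ₐ[ℚ] QBar).comp φ) = φ := by
          ext x; exact s.symm_apply_apply _
        rw [h3, map_mul]
        simp only [c, c', h4]
        split_ifs <;> simp
      rw [h2] at h1
      simp [sub_mul, Finset.sum_sub_distrib, h1])
    funext φ
    exact sub_eq_zero.1 (h0 φ)
  have h := congrFun hcc ((s : QBar →ₐ[ℚ] QBar).comp ε)
  have h4 : (s.symm : QBar →ₐ[ℚ] QBar).comp ((s : QBar →ₐ[ℚ] QBar).comp ε) = ε := by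
    ext x; exact s.symm_apply_apply _
  simp only [c, c', h4, hε, if_true] at h
  by_contra hn
  simp [hn] at h

end Galois

/-! ### Homomorphisms out of `T^K` are determined by one cocharacter -/

section Torus

variable (K : Type) [Field K] [NumberField K]

theorem splitEquiv_comp {A : Type} [CommRing A] [Algebra ℚ A] (u : QBar →ₐ[ℚ] A)
    (σ : QBar ≃ₐ[ℚ] QBar) (x : K ⊗[ℚ] A) (κ : K →ₐ[ℚ] QBar) :
    splitEquiv K A (u.comp σ) x κ = splitEquiv K A u x ((σ : QBar →ₐ[ℚ] QBar).comp κ) := by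
  induction x with
  | zero => simp
  | add x y hx hy => simp only [map_add, Pi.add_apply, hx, hy]
  | tmul k a => rfl

theorem units_splitEquiv_ext {A : Type} [CommRing A] [Algebra ℚ A] (u : QBar →ₐ[ℚ] A)
    {x y : (K ⊗[ℚ] A)ˣ}
    (h : ∀ κ, splitEquiv K A u (x : K ⊗[ℚ] A) κ = splitEquiv K A u (y : K ⊗[ℚ] A) κ) : x = y :=
  Units.ext ((splitEquiv K A u).injective (funext h))

/-- The group `(K ⊗ A)ˣ` does not see the `QBar`-structure of `A`; changing that structure only
permutes the factors of the splitting. This is how one cocharacter yields all its conjugates. -/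
theorem muPhiPoints_comp (κ : K →ₐ[ℚ] QBar) {A : Type} [CommRing A] [Algebra ℚ A]
    (u : QBar →ₐ[ℚ] A) (σ : QBar ≃ₐ[ℚ] QBar) (z : Aˣ) :
    muPhiPoints K {κ} A (u.comp σ) z =
      muPhiPoints K {(σ : QBar →ₐ[ℚ] QBar).comp κ} A u z := by
  classical
  refine units_splitEquiv_ext K (u.comp σ) fun κ' => ?_
  rw [splitEquiv_muPhiPoints, splitEquiv_comp, splitEquiv_muPhiPoints]
  have : (σ : QBar →ₐ[ℚ] QBar).comp κ' = (σ : QBar →ₐ[ℚ] QBar).comp κ ↔ κ' = κ := by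
    refine ⟨fun h => AlgHom.ext fun x => σ.injective (DFunLike.congr_fun h x), fun h => by rw [h]⟩
  simp only [Set.mem_singleton_iff, this]

theorem eq_prod_muPhiPoints {A : Type} [CommRing A] [Algebra ℚ A] (u : QBar →ₐ[ℚ] A)
    (x : (K ⊗[ℚ] A)ˣ) :
    x = ∏ κ, muPhiPoints K {κ} A u
      (Units.map ((Pi.evalRingHom (fun _ : K →ₐ[ℚ] QBar => A) κ).comp
        (splitEquiv K A u : K ⊗[ℚ] A →+* _) : _ →* _) x) := by
  classical
  refine units_splitEquiv_ext K u fun κ => ?_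
  rw [Units.coe_prod, map_prod, Finset.prod_apply, Finset.prod_eq_single κ]
  · rw [splitEquiv_muPhiPoints, if_pos (Set.mem_singleton κ)]
    rfl
  · intro κ' _ h
    rw [splitEquiv_muPhiPoints, if_neg fun h' => h (Set.mem_singleton_iff.1 h').symm]
  · simp

/-- The `QBar`-algebra `A` with structure map `u`, as an object of `AlgOver QBar`. -/
abbrev qbarAlg (A : Type) [CommRing A] [Algebra ℚ A] (u : QBar →ₐ[ℚ] A) : AlgOver QBar :=
  Under.mk (Y := CommAlgCat.of ℚ A) (CommAlgCat.ofHom u)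

theorem map_includeRight_injective (L R : Type) [Field L] [CharZero L] [CommRing R] [Algebra ℚ R] :
    Function.Injective (Algebra.TensorProduct.map (AlgHom.id ℚ L)
      (Algebra.TensorProduct.includeRight : R →ₐ[ℚ] QBar ⊗[ℚ] R)) :=
  Module.Flat.lTensor_preserves_injective_linearMap (M := L)
    (Algebra.TensorProduct.includeRight : R →ₐ[ℚ] QBar ⊗[ℚ] R).toLinearMap
    (Algebra.TensorProduct.includeRight_injective (algebraMap ℚ QBar).injective)

variable {K}

/-- The hypothesis holds for `A` with each twisted structure `u ∘ σ`, so `h` and `h'` agree on the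
values of every `μ_κ`, and these generate `(K ⊗ A)ˣ`. -/
theorem torus_hom_app_muPhiPoints_ext (τ : K →ₐ[ℚ] QBar) {H : QGroup} {h h' : torus K ⟶ H}
    (hh : muPhi K {τ} ≫ extendScalarsMap QBar h = muPhi K {τ} ≫ extendScalarsMap QBar h')
    {A : Type} [CommRing A] [Algebra ℚ A] (u : QBar →ₐ[ℚ] A) (x : (K ⊗[ℚ] A)ˣ) :
    (h.app (CommAlgCat.of ℚ A)).hom x = (h'.app (CommAlgCat.of ℚ A)).hom x := by
  suffices hx : x ∈ (h.app (CommAlgCat.of ℚ A)).hom.eqLocus (h'.app (CommAlgCat.of ℚ A)).hom from hx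
  have hmem : ∀ (κ : K →ₐ[ℚ] QBar) (z : Aˣ), muPhiPoints K {κ} A u z ∈
      (h.app (CommAlgCat.of ℚ A)).hom.eqLocus (h'.app (CommAlgCat.of ℚ A)).hom := by
    intro κ z
    obtain ⟨σ, rfl⟩ := exists_galois_comp_eq κ τ
    rw [← muPhiPoints_comp]
    exact DFunLike.congr_fun (congrArg GrpCat.Hom.hom
      (NatTrans.congr_app hh (qbarAlg A (u.comp (σ : QBar →ₐ[ℚ] QBar))))) z
  rw [eq_prod_muPhiPoints K u x]
  exact Subgroup.prod_mem (G := (K ⊗[ℚ] A)ˣ) _ fun κ _ => hmem κ _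

/-- A homomorphism `T^K → T^L` is determined by its composite with `μ_τ`. -/
theorem torus_hom_ext (τ : K →ₐ[ℚ] QBar) {L : Type} [Field L] [NumberField L]
    {h h' : torus K ⟶ torus L}
    (hh : muPhi K {τ} ≫ extendScalarsMap QBar h = muPhi K {τ} ≫ extendScalarsMap QBar h') :
    h = h' := by
  ext R x
  -- `QBar ⊗ R` is a `QBar`-algebra, and `R → QBar ⊗ R` stays injective after the flat base change
  -- to `L`.
  let g : R ⟶ CommAlgCat.of ℚ (QBar ⊗[ℚ] R) :=
    CommAlgCat.ofHom Algebra.TensorProduct.includeRight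
  have h1 := ConcreteCategory.congr_hom (h.naturality g) x
  have h2 := ConcreteCategory.congr_hom (h'.naturality g) x
  have h3 := torus_hom_app_muPhiPoints_ext τ hh
    (Algebra.TensorProduct.includeLeft : QBar →ₐ[ℚ] QBar ⊗[ℚ] R) ((torus K).map g x)
  refine Units.ext (map_includeRight_injective L R ?_)
  exact congrArg Units.val (h1.symm.trans (h3.trans h2))

end Torus

/-! ### Elements of `QBar ⊗ A` for a `QBar`-algebra `A` -/

section Mult

variable {A : Type} [CommRing A] [Algebra ℚ A]

/-- The homomorphism `QBar ⊗ A → A`, `q ⊗ a ↦ u(q) a`. -/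
def qbarMul (u : QBar →ₐ[ℚ] A) : QBar ⊗[ℚ] A →ₐ[ℚ] A :=
  Algebra.TensorProduct.lift u (AlgHom.id ℚ A) fun _ _ => mul_comm _ _

theorem qbarMul_map (u : QBar →ₐ[ℚ] A) {K : Type} [Field K] [NumberField K] (κ : K →ₐ[ℚ] QBar)
    (x : K ⊗[ℚ] A) :
    qbarMul u (Algebra.TensorProduct.map κ (AlgHom.id ℚ A) x) = splitEquiv K A u x κ := by
  induction x with
  | zero => simp
  | add x y hx hy => simp only [map_add, Pi.add_apply, hx, hy]
  | tmul k a => rfl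

theorem exists_numberField_tensor (y : QBar ⊗[ℚ] A) :
    ∃ (F : Type) (_ : Field F) (_ : NumberField F) (ν : F →ₐ[ℚ] QBar) (x : F ⊗[ℚ] A),
      Algebra.TensorProduct.map ν (AlgHom.id ℚ A) x = y := by
  classical
  obtain ⟨S, rfl⟩ := TensorProduct.exists_finset y
  let F := IntermediateField.adjoin ℚ ((S.image Prod.fst : Finset QBar) : Set QBar)
  have hfin : FiniteDimensional ℚ F :=
    IntermediateField.finiteDimensional_adjoin fun q _ => Algebra.IsIntegral.isIntegral q
  have hF : NumberField F := { to_finiteDimensional := by convert hfin }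
  have hmem : ∀ i : S, i.1.1 ∈ F := fun i => IntermediateField.subset_adjoin _ _
    (Finset.mem_coe.2 (Finset.mem_image_of_mem _ i.2))
  refine ⟨F, inferInstance, hF, (F.val : F →+* QBar).toRatAlgHom,
    ∑ i : S, (⟨i.1.1, hmem i⟩ : F) ⊗ₜ i.1.2, ?_⟩
  rw [map_sum, ← Finset.sum_coe_sort S]
  rfl

/-- An element of `QBar ⊗ A` comes from `F ⊗ A` for some number field `F`. That algebra splits into
copies of `A` indexed by the embeddings of `F`, all of which are `σ ∘ ν` for one fixed `ν`. -/
theorem eq_of_forall_qbarMul_eq (u : QBar →ₐ[ℚ] A) {y y' : QBar ⊗[ℚ] A}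
    (h : ∀ σ : QBar ≃ₐ[ℚ] QBar,
      qbarMul (u.comp (σ : QBar →ₐ[ℚ] QBar)) y = qbarMul (u.comp (σ : QBar →ₐ[ℚ] QBar)) y') :
    y = y' := by
  rw [← sub_eq_zero]
  obtain ⟨F, _, _, ν, x, hx⟩ := exists_numberField_tensor (y - y')
  have h0 : x = 0 := by
    refine (splitEquiv F A u).injective (funext fun κ => ?_)
    obtain ⟨σ, rfl⟩ := exists_galois_comp_eq κ ν
    rw [← splitEquiv_comp, ← qbarMul_map, hx, map_sub, h σ, sub_self, map_zero]
    rfl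
  rw [← hx, h0, map_zero]

end Mult

/-! ### `μ_τ` followed by `π^K` and norms of Serre groups -/

section Serre

variable {K L : Type} [Field K] [NumberField K] [Field L] [NumberField L]

open Classical in
-- After the test map `q ⊗ a ↦ u(σ q) a`, the factor at `κ` is `z` if `σκ = τ` and `1` otherwise.
-- The only candidate `κ = σ⁻¹τ` lies above `ν` exactly when `σν` is the restriction of `τ`.
theorem embUnits_muPhiPoints_comp (j : L →ₐ[ℚ] K) (τ : K →ₐ[ℚ] QBar) {A : Type} [CommRing A]
    [Algebra ℚ A] (u : QBar →ₐ[ℚ] A) (z : Aˣ) (ν : L →ₐ[ℚ] QBar) :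
    ∏ κ : K →ₐ[ℚ] QBar with AlgHom.comp κ j = ν, embUnits K κ (muPhiPoints K {τ} A u z) =
      embUnits L ν (muPhiPoints L {τ.comp j} A u z) := by
  refine Units.ext (eq_of_forall_qbarMul_eq u fun σ => ?_)
  have h : ∀ {M : Type} [Field M] [NumberField M] (κ τ : M →ₐ[ℚ] QBar),
      qbarMul (u.comp (σ : QBar →ₐ[ℚ] QBar))
        (embUnits M κ (muPhiPoints M {τ} A u z) : (QBar ⊗[ℚ] A)ˣ) =
      if (σ : QBar →ₐ[ℚ] QBar).comp κ = τ then (z : A) else 1 := by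
    intro M _ _ κ τ
    refine (qbarMul_map _ κ _).trans ?_
    rw [splitEquiv_comp, splitEquiv_muPhiPoints]
    rfl
  rw [Units.coe_prod, map_prod]
  simp only [h]
  rw [Finset.prod_filter]
  have h2 : ∀ κ : K →ₐ[ℚ] QBar, (σ : QBar →ₐ[ℚ] QBar).comp κ = τ ↔
      κ = (σ.symm : QBar →ₐ[ℚ] QBar).comp τ := by
    intro κ
    constructor
    · rintro rfl
      ext x
      exact (σ.symm_apply_apply _).symm
    · rintro rfl
      ext x
      exact σ.apply_symm_apply _
  rw [Finset.prod_eq_single ((σ.symm : QBar →ₐ[ℚ] QBar).comp τ)]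
  · rw [if_pos ((h2 _).2 rfl)]
    congr 1
    refine propext ⟨?_, fun h3 => ?_⟩
    · rintro rfl
      ext x
      exact σ.apply_symm_apply _
    · ext x
      exact (AlgEquiv.symm_apply_eq σ).2 (DFunLike.congr_fun h3 x).symm
  · intro κ _ hκ
    rw [if_neg fun h3 => hκ ((h2 _).1 h3), ite_self]
  · simp

/-- The exponent is constant on each set of embeddings of `K` with a given restriction to `L`, so
the product can be taken fibrewise. -/
theorem evalChar_muPhiPoints_comp (j : L →ₐ[ℚ] K) (τ : K →ₐ[ℚ] QBar) {A : Type} [CommRing A]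
    [Algebra ℚ A] (u : QBar →ₐ[ℚ] A) (z : Aˣ) (f : (L →ₐ[ℚ] QBar) → ℤ) :
    evalChar K A (muPhiPoints K {τ} A u z) (Multiplicative.ofAdd fun κ => f (κ.comp j)) =
      evalChar L A (muPhiPoints L {τ.comp j} A u z) (Multiplicative.ofAdd f) := by
  classical
  change ∏ κ, embUnits K κ _ ^ f (κ.comp j) = ∏ ν, embUnits L ν _ ^ f ν
  rw [← Finset.prod_fiberwise (s := Finset.univ) (g := fun κ : K →ₐ[ℚ] QBar => κ.comp j)]
  refine Finset.prod_congr rfl fun ν _ => ?_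
  rw [← embUnits_muPhiPoints_comp, ← Finset.prod_zpow]
  refine Finset.prod_congr rfl fun κ hκ => ?_
  rw [(Finset.mem_filter.1 hκ).2]

/-- This replaces the chain of norms in `φ` by a restriction of `τ`, so that the defining property
of `ρ_Φ` can be applied. -/
theorem serreCochar_serreNorm (j : L →ₐ[ℚ] K) (τ : K →ₐ[ℚ] QBar) :
    serreCochar K τ ≫ extendScalarsMap QBar (serreNorm j) = serreCochar L (τ.comp j) := by
  ext A z
  refine Subtype.ext (MonoidHom.ext fun m => ?_)
  exact evalChar_muPhiPoints_comp j τ A.hom.hom z m.toAdd.1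

end Serre

/-! ### Norms over a `QBar`-algebra -/

section Norm

theorem Algebra.norm_pi_const {ι B : Type} [Fintype ι] [CommRing B] (w : ι → B) :
    Algebra.norm B w = ∏ i, w i := by
  classical
  rw [Algebra.norm_eq_matrix_det (Pi.basisFun B ι)]
  have : Algebra.leftMulMatrix (Pi.basisFun B ι) w = Matrix.diagonal w := by
    ext i j
    rw [Algebra.leftMulMatrix_eq_repr_mul]
    simp [Matrix.diagonal, Pi.single_apply]
  rw [this, Matrix.det_diagonal]

variable (K : Type) [Field K] [NumberField K]

/-- The map `K ⊗ A → A`, `k ⊗ a ↦ κ(k) a`. -/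
def splitProj (A : Type) [CommRing A] [Algebra ℚ A] (u : QBar →ₐ[ℚ] A) (κ : K →ₐ[ℚ] QBar) :
    K ⊗[ℚ] A →ₐ[ℚ] A :=
  (Pi.evalAlgHom ℚ (fun _ : K →ₐ[ℚ] QBar => A) κ).comp (splitEquiv K A u : K ⊗[ℚ] A →ₐ[ℚ] _)

variable {K}

theorem norm_eq_prod_splitEquiv {B : Type} [CommRing B] [Algebra ℚ B] (v : QBar →ₐ[ℚ] B)
    (x : B ⊗[ℚ] K) :
    Algebra.norm B x =
      ∏ κ, splitEquiv K B v (Algebra.TensorProduct.comm ℚ B K x) κ := by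
  let e₀ : B ⊗[ℚ] K ≃ₐ[ℚ] ((K →ₐ[ℚ] QBar) → B) :=
    (Algebra.TensorProduct.comm ℚ B K).trans (splitEquiv K B v)
  let e : B ⊗[ℚ] K ≃ₐ[B] ((K →ₐ[ℚ] QBar) → B) :=
    AlgEquiv.ofRingEquiv (f := e₀.toRingEquiv) fun b => by
      funext κ
      change v (κ 1) * b = b
      rw [map_one, map_one, one_mul]
  rw [← Algebra.norm_eq_of_algEquiv e, Algebra.norm_pi_const]
  rfl

/-- The extension is split because `E ⊗ A` is a `QBar`-algebra through `A`. Each factor is the image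
under a map induced by a ring homomorphism `K ⊗ A → A`, a form suited to naturality arguments. -/
theorem relNorm_eq_prod {E A : Type} [CommRing E] [Algebra ℚ E] [CommRing A] [Algebra ℚ A]
    (u : QBar →ₐ[ℚ] A) (w : E ⊗[ℚ] (K ⊗[ℚ] A)) :
    relNorm K E A w =
      ∏ κ, Algebra.TensorProduct.map (AlgHom.id ℚ E) (splitProj K A u κ) w := by
  let v : QBar →ₐ[ℚ] E ⊗[ℚ] A := Algebra.TensorProduct.includeRight.comp u
  refine (norm_eq_prod_splitEquiv v _).trans (Finset.prod_congr rfl fun κ _ => ?_)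
  change splitEquiv K (E ⊗[ℚ] A) v (Algebra.TensorProduct.comm ℚ (E ⊗[ℚ] A) K
    (swapEquiv K E A w)) κ = _
  induction w with
  | zero => simp
  | add x y hx hy => simp only [map_add, Pi.add_apply, hx, hy]
  | tmul e y =>
    induction y with
    | zero => simp
    | add x y hx hy => simp only [map_add, tmul_add, Pi.add_apply, hx, hy]
    | tmul k a =>
      change (1 ⊗ₜ u (κ k)) * (e ⊗ₜ a) = e ⊗ₜ[ℚ] (u (κ k) * a)
      rw [Algebra.TensorProduct.tmul_mul_tmul, one_mul]

end Norm

/-! ### The two homomorphisms agree on `μ_τ` -/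

section Agree

variable {K : Type} [Field K] [NumberField K] (τ : K →ₐ[ℚ] QBar)
  {r : ℕ} {Ei : Fin r → Type} [∀ i, Field (Ei i)] [∀ i, NumberField (Ei i)]
  [∀ i, NumberField.IsCMField (Ei i)] (Φ : Π i, Set (Ei i →ₐ[ℚ] QBar))

/-- A homomorphism `T^K → 𝒯` whose composite with `μ_τ` is `∏ μ_{Φ_i}`. -/
def IsCMHom (h : torus K ⟶ calT Ei) : Prop :=
  ∀ i, muPhi K {τ} ≫ extendScalarsMap QBar (h ≫ calTProj Ei i) = muPhi (Ei i) (Φ i)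

variable {τ Φ}

omit [NumberField K] in
theorem calT_hom_ext {G : QGroup} {h h' : G ⟶ calT Ei}
    (hh : ∀ i, h ≫ calTProj Ei i = h' ≫ calTProj Ei i) : h = h' := by
  ext R x
  refine Subtype.ext (funext fun i => ?_)
  exact ConcreteCategory.congr_hom (NatTrans.congr_app (hh i) R) x

theorem IsCMHom.unique {h h' : torus K ⟶ calT Ei} (hh : IsCMHom τ Φ h) (hh' : IsCMHom τ Φ h') :
    h = h' :=
  calT_hom_ext fun i => torus_hom_ext τ ((hh i).trans (hh' i).symm)

/-- On cocharacters, the two norms take `τ` to its restriction to `E` and then to `E_i^*`, which is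
the inclusion `E_i^* → QBar`. -/
theorem isCMHom_of_isRhoPhi (E : IntermediateField ℚ K)
    (hΦE : ∀ i, reflexField (Φ i) ≤ E.map τ)
    {ρ : Π i, serreGroup (reflexField (Φ i)) ⟶ torus (Ei i)} {f : serreGroup E ⟶ calT Ei}
    (hρ : ∀ i, IsRhoPhi (Φ i) (ρ i))
    (hf : ∀ i, f ≫ calTProj Ei i = serreNorm (inclOfLE τ E (reflexField (Φ i)) (hΦE i)) ≫ ρ i) :
    IsCMHom τ Φ (serreQuotient K ≫ serreNorm (subfieldIncl E) ≫ f) := by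
  intro i
  have hj : (τ.comp (subfieldIncl E)).comp (inclOfLE τ E (reflexField (Φ i)) (hΦE i)) =
      reflexField.incl (Φ i) := AlgHom.ext fun x => inclOfLE_spec τ E _ (hΦE i) x
  rw [Category.assoc, Category.assoc, hf i, hρ i, ← hj, ← serreCochar_serreNorm,
    ← serreCochar_serreNorm]
  rfl

theorem splitProj_muPhiPoints (A : Type) [CommRing A] [Algebra ℚ A] (u : QBar →ₐ[ℚ] A) (z : Aˣ)
    (κ : K →ₐ[ℚ] QBar) (hκ : κ ≠ τ) :
    Units.map (splitProj K A u κ : K ⊗[ℚ] A →* A) (muPhiPoints K {τ} A u z) = 1 := by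
  classical
  exact Units.ext ((splitEquiv_muPhiPoints K {τ} A u z κ).trans (if_neg hκ))

theorem splitProj_muPhiPoints_self (A : Type) [CommRing A] [Algebra ℚ A] (u : QBar →ₐ[ℚ] A)
    (z : Aˣ) :
    Units.map (splitProj K A u τ : K ⊗[ℚ] A →* A) (muPhiPoints K {τ} A u z) = z := by
  classical
  exact Units.ext ((splitEquiv_muPhiPoints K {τ} A u z τ).trans (if_pos rfl))

/-- The map `K ⊗ A → A`, `k ⊗ a ↦ κ(k) a`, as a homomorphism of `K`-algebras. -/
def splitProjOver (A : AlgOver QBar) (κ : K →ₐ[ℚ] QBar) :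
    (tensorFunctor K).obj A.right ⟶ (Under.map (CommAlgCat.ofHom κ)).obj A :=
  Under.homMk (CommAlgCat.ofHom (splitProj K A.right A.hom.hom κ)) (by
    ext k
    change A.hom.hom (κ k) * 1 = A.hom.hom (κ k)
    rw [mul_one])

/-- The norm of `μ(t)`, for `t = μ_τ(z)`, is the product over `κ` of its images in `A`. Each image
is `μ` applied to the `κ`-component of `t`, which is `z` for `κ = τ` and `1` otherwise. -/
theorem isCMHom_of_isMuCM {μ : extendScalars K Gm ⟶ extendScalars K (calT Ei)}
    (hμ : IsMuCM τ Φ μ) : IsCMHom τ Φ (weilRestrictionMap K μ ≫ calTNorm Ei K) := by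
  classical
  intro i
  ext A z
  let u : QBar →ₐ[ℚ] A.right := A.hom.hom
  let t : (K ⊗[ℚ] A.right)ˣ := muPhiPoints K {τ} A.right u z
  let w : calTPoints Ei (K ⊗[ℚ] A.right) := (μ.app ((tensorFunctor K).obj A.right)).hom t
  refine Units.ext ((relNorm_eq_prod u (w.1 i : Ei i ⊗[ℚ] (K ⊗[ℚ] A.right))).trans ?_)
  -- Naturality of `μ` along `K ⊗ A → A`, which is a map of `K`-algebras once `K` acts on `A`
  -- through `κ`.
  have hw : ∀ (κ : K →ₐ[ℚ] QBar) (s : A.rightˣ),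
      Units.map (splitProj K A.right u κ : K ⊗[ℚ] A.right →* A.right) t = s →
      (Units.map (Algebra.TensorProduct.map (AlgHom.id ℚ (Ei i)) (splitProj K A.right u κ) :
        Ei i ⊗[ℚ] (K ⊗[ℚ] A.right) →* Ei i ⊗[ℚ] A.right) (w.1 i) : (Ei i ⊗[ℚ] A.right)ˣ) =
        ((μ.app ((Under.map (CommAlgCat.ofHom κ)).obj A)).hom s : calTPoints Ei A.right).1 i := by
    rintro κ s rfl
    have h0 := DFunLike.congr_fun (congrArg GrpCat.Hom.hom (μ.naturality (splitProjOver A κ))) t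
    exact congrArg (fun x : calTPoints Ei A.right => x.1 i) h0.symm
  rw [Finset.prod_eq_single τ]
  · exact congrArg Units.val ((hw τ z (splitProj_muPhiPoints_self _ _ _)).trans
      (DFunLike.congr_fun (congrArg GrpCat.Hom.hom (hμ A i)) z))
  · intro κ _ hκ
    have h1 : ((μ.app ((Under.map (CommAlgCat.ofHom κ)).obj A)).hom (1 : A.rightˣ) :
        calTPoints Ei A.right).1 i = 1 :=
      congrArg (fun x : calTPoints Ei A.right => x.1 i)
        (map_one (μ.app ((Under.map (CommAlgCat.ofHom κ)).obj A)).hom)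
    exact congrArg Units.val ((hw κ 1 (splitProj_muPhiPoints _ _ _ _ hκ)).trans h1)
  · simp

end Agree

/-! ### Galois descent for `L ⊗ R` -/

section Descent

variable {L : Type} [Field L] [NumberField L] {R : Type} [CommRing R] [Algebra ℚ R]

theorem map_algHom_injective (ν : L →ₐ[ℚ] QBar) :
    Function.Injective (Algebra.TensorProduct.map ν (AlgHom.id ℚ R)) :=
  Module.Flat.rTensor_preserves_injective_linearMap (M := R) ν.toLinearMap ν.injective

theorem embUnits_injective (ν : L →ₐ[ℚ] QBar) :
    Function.Injective (embUnits L (R := R) ν) :=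
  Units.map_injective (map_algHom_injective ν)

instance nonempty_algHom_qbar : Nonempty (L →ₐ[ℚ] QBar) :=
  ⟨IsAlgClosed.lift⟩

theorem map_comp_algHom {M N P : Type} [Field M] [CharZero M] [Field N] [CharZero N] [Field P]
    [CharZero P] (σ : N →ₐ[ℚ] P) (ν : M →ₐ[ℚ] N) (x : M ⊗[ℚ] R) :
    Algebra.TensorProduct.map (σ.comp ν) (AlgHom.id ℚ R) x =
      Algebra.TensorProduct.map σ (AlgHom.id ℚ R)
        (Algebra.TensorProduct.map ν (AlgHom.id ℚ R) x) := by
  induction x with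
  | zero => simp
  | add x y hx hy => simp only [map_add, hx, hy]
  | tmul k a => simp

/-- Equivariance makes the value at one embedding `ν₀` invariant under the stabiliser of `ν₀`. Its
coordinates in a `ℚ`-basis of `R` therefore lie in `ν₀(L)`, and transitivity of Galois handles the
other embeddings. -/
theorem exists_of_equivariant (y : (L →ₐ[ℚ] QBar) → QBar ⊗[ℚ] R)
    (hy : ∀ (σ : QBar ≃ₐ[ℚ] QBar) ν, y ((σ : QBar →ₐ[ℚ] QBar).comp ν) =
      Algebra.TensorProduct.map (σ : QBar →ₐ[ℚ] QBar) (AlgHom.id ℚ R) (y ν)) :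
    ∃ x : L ⊗[ℚ] R, ∀ ν, Algebra.TensorProduct.map ν (AlgHom.id ℚ R) x = y ν := by
  obtain ⟨ν₀⟩ : Nonempty (L →ₐ[ℚ] QBar) := inferInstance
  let b := Module.Free.chooseBasis ℚ R
  let c := (b.baseChange QBar).repr (y ν₀)
  have hrepr : ∀ (σ : QBar ≃ₐ[ℚ] QBar) (w : QBar ⊗[ℚ] R) i,
      (b.baseChange QBar).repr
        (Algebra.TensorProduct.map (σ : QBar →ₐ[ℚ] QBar) (AlgHom.id ℚ R) w) i =
      σ ((b.baseChange QBar).repr w i) := by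
    intro σ w i
    induction w with
    | zero => simp
    | add x y hx hy => simp only [map_add, Finsupp.add_apply, hx, hy]
    | tmul q a =>
      simp only [Algebra.TensorProduct.map_tmul, Module.Basis.baseChange_repr_tmul]
      exact (map_smul (σ : QBar →ₐ[ℚ] QBar).toLinearMap _ _).symm
  have hc : ∀ i, ∃ k, ν₀ k = c i := fun i => mem_range_of_forall_fixed ν₀ fun σ hσ => by
    rw [← hrepr, ← hy, hσ]
  choose k hk using hc
  have h0 : Algebra.TensorProduct.map ν₀ (AlgHom.id ℚ R) (∑ i ∈ c.support, k i ⊗ₜ b i) =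
      y ν₀ := by
    rw [map_sum, ← (b.baseChange QBar).linearCombination_repr (y ν₀),
      Finsupp.linearCombination_apply, Finsupp.sum]
    refine Finset.sum_congr rfl fun i _ => ?_
    simp [hk, c, TensorProduct.smul_tmul']
  refine ⟨∑ i ∈ c.support, k i ⊗ₜ b i, fun ν => ?_⟩
  obtain ⟨σ, rfl⟩ := exists_galois_comp_eq ν ν₀
  rw [map_comp_algHom, h0, hy]

theorem exists_units_of_equivariant (y : (L →ₐ[ℚ] QBar) → (QBar ⊗[ℚ] R)ˣ)
    (hy : ∀ (σ : QBar ≃ₐ[ℚ] QBar) ν, y ((σ : QBar →ₐ[ℚ] QBar).comp ν) = galUnits R σ (y ν)) :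
    ∃ x : (L ⊗[ℚ] R)ˣ, ∀ ν, embUnits L ν x = y ν := by
  obtain ⟨x, hx⟩ := exists_of_equivariant (fun ν => (y ν : QBar ⊗[ℚ] R))
    fun σ ν => congrArg Units.val (hy σ ν)
  -- The inverses form an equivariant family too; what they descend to is inverse to `x`, by
  -- injectivity at one embedding.
  obtain ⟨x', hx'⟩ := exists_of_equivariant (fun ν => ((y ν)⁻¹ : (QBar ⊗[ℚ] R)ˣ).val)
    fun σ ν => by
      rw [hy, ← map_inv]
      rfl
  obtain ⟨ν₀⟩ : Nonempty (L →ₐ[ℚ] QBar) := inferInstance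
  have h : x * x' = 1 := map_algHom_injective ν₀ (by
    rw [map_mul, hx, hx', Units.mul_inv, map_one])
  exact ⟨⟨x, x', h, by rw [mul_comm, h]⟩, fun ν => Units.ext (hx ν)⟩

end Descent

/-! ### The characters of `S^{E^*}` that make up `ρ_Φ` -/

section CMChar

variable {E : Type} [Field E] [NumberField E] (Φ : Set (E →ₐ[ℚ] QBar))

open Classical in
/-- The function on `Hom(E^*, QBar)` with value `1` at `σ|_{E^*}` if `σ⁻¹ ∘ ε ∈ Φ`,
and `0` otherwise. -/
def cmCharFun (ε : E →ₐ[ℚ] QBar) (ν : reflexField Φ →ₐ[ℚ] QBar) : ℤ :=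
  if ∃ σ : QBar ≃ₐ[ℚ] QBar, (σ : QBar →ₐ[ℚ] QBar).comp (reflexField.incl Φ) = ν ∧
    (σ.symm : QBar →ₐ[ℚ] QBar).comp ε ∈ Φ then 1 else 0

theorem symm_comp_comp {M : Type} [Field M] [NumberField M] (σ : QBar ≃ₐ[ℚ] QBar)
    (ν : M →ₐ[ℚ] QBar) :
    (σ.symm : QBar →ₐ[ℚ] QBar).comp ((σ : QBar →ₐ[ℚ] QBar).comp ν) = ν :=
  AlgHom.ext fun x => σ.symm_apply_apply (ν x)

theorem comp_symm_comp {M : Type} [Field M] [NumberField M] (σ : QBar ≃ₐ[ℚ] QBar)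
    (ν : M →ₐ[ℚ] QBar) :
    (σ : QBar →ₐ[ℚ] QBar).comp ((σ.symm : QBar →ₐ[ℚ] QBar).comp ν) = ν :=
  AlgHom.ext fun x => σ.apply_symm_apply (ν x)

open Classical in
-- The choice of `σ` does not matter: two choices differ by an automorphism fixing `E^*`, and these
-- preserve `Φ`.
theorem cmCharFun_comp_incl (ε : E →ₐ[ℚ] QBar) (σ : QBar ≃ₐ[ℚ] QBar) :
    cmCharFun Φ ε ((σ : QBar →ₐ[ℚ] QBar).comp (reflexField.incl Φ)) =
      if (σ.symm : QBar →ₐ[ℚ] QBar).comp ε ∈ Φ then 1 else 0 := by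
  unfold cmCharFun
  congr 1
  refine propext ⟨?_, fun h => ⟨σ, rfl, h⟩⟩
  rintro ⟨s, hs, h⟩
  have h1 : ((σ.symm * s : QBar ≃ₐ[ℚ] QBar) : QBar →ₐ[ℚ] QBar).comp (reflexField.incl Φ) =
      reflexField.incl Φ := by
    change (σ.symm : QBar →ₐ[ℚ] QBar).comp ((s : QBar →ₐ[ℚ] QBar).comp _) = _
    rw [hs, symm_comp_comp]
  have h2 := comp_mem_of_comp_incl_eq Φ _ h1 h
  change (σ.symm : QBar →ₐ[ℚ] QBar).comp ((s : QBar →ₐ[ℚ] QBar).comp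
    ((s.symm : QBar →ₐ[ℚ] QBar).comp ε)) ∈ Φ at h2
  rwa [comp_symm_comp] at h2

theorem galAct_cmCharFun (s : QBar ≃ₐ[ℚ] QBar) (ε : E →ₐ[ℚ] QBar) :
    galAct _ s (cmCharFun Φ ε) = cmCharFun Φ ((s : QBar →ₐ[ℚ] QBar).comp ε) := by
  classical
  funext ν
  obtain ⟨σ, rfl⟩ := exists_galois_comp_eq ν (reflexField.incl Φ)
  rw [cmCharFun_comp_incl]
  exact cmCharFun_comp_incl Φ ε (s.symm * σ)

variable {Φ} [NumberField.IsCMField E]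

theorem IsCMType.conj_mem_iff (hΦ : IsCMType E Φ) (ε : E →ₐ[ℚ] QBar) :
    (conjQBar : QBar →ₐ[ℚ] QBar).comp ε ∈ Φ ↔ ε ∉ Φ := by
  have hcc : (conjQBar : QBar →ₐ[ℚ] QBar).comp ((conjQBar : QBar →ₐ[ℚ] QBar).comp ε) = ε :=
    AlgHom.ext fun x => conjQBar_conjQBar (ε x)
  constructor
  · intro h1 h2
    have h3 : ε ∈ Φ ∩ (fun φ => (conjQBar : QBar →ₐ[ℚ] QBar).comp φ) '' Φ := ⟨h2, _, h1, hcc⟩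
    rw [hΦ.inter_conj] at h3
    exact h3
  · intro h
    have h1 : ε ∈ Φ ∪ (fun φ => (conjQBar : QBar →ₐ[ℚ] QBar).comp φ) '' Φ := by
      rw [hΦ.union_conj]; trivial
    obtain h1 | ⟨φ, hφ, rfl⟩ := h1
    · exact absurd h1 h
    · have hφφ : (conjQBar : QBar →ₐ[ℚ] QBar).comp ((conjQBar : QBar →ₐ[ℚ] QBar).comp φ) = φ :=
        AlgHom.ext fun x => conjQBar_conjQBar (φ x)
      change (conjQBar : QBar →ₐ[ℚ] QBar).comp ((conjQBar : QBar →ₐ[ℚ] QBar).comp φ) ∈ Φ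
      rwa [hφφ]

/-- Exactly one of `σ⁻¹ε` and `ισ⁻¹ε` lies in `Φ`. This gives both the Serre condition and the
similitude condition of `𝒯`. -/
theorem cmCharFun_conj_add (hΦ : IsCMType E Φ) (ε : E →ₐ[ℚ] QBar) :
    cmCharFun Φ ((conjQBar : QBar →ₐ[ℚ] QBar).comp ε) + cmCharFun Φ ε = fun _ => 1 := by
  classical
  funext ν
  obtain ⟨σ, rfl⟩ := exists_galois_comp_eq ν (reflexField.incl Φ)
  rw [Pi.add_apply, cmCharFun_comp_incl, cmCharFun_comp_incl]
  -- Both sides are `σ⁻¹ε` precomposed with the conjugation of the CM field `E`.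
  have h : (σ.symm : QBar →ₐ[ℚ] QBar).comp ((conjQBar : QBar →ₐ[ℚ] QBar).comp ε) =
      (conjQBar : QBar →ₐ[ℚ] QBar).comp ((σ.symm : QBar →ₐ[ℚ] QBar).comp ε) := by
    rw [← comp_conjCM, ← comp_conjCM]
    rfl
  rw [h]
  simp only [hΦ.conj_mem_iff]
  split_ifs <;> simp

/-- The constant function `1`, as a character of `S^E`. -/
def serreOne (E : Type) [Field E] [NumberField E] : serreLattice E :=
  ⟨fun _ => 1, fun _ => ⟨rfl, rfl⟩⟩

/-- The character `cmCharFun` of `S^{E^*}`. -/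
def cmChar (hΦ : IsCMType E Φ) (ε : E →ₐ[ℚ] QBar) : serreLattice (reflexField Φ) :=
  ⟨cmCharFun Φ ε, fun σ => by
    -- `(ι + 1)` sends the character at any embedding to the constant `1`, which Galois fixes; the
    -- second condition becomes `1 - 1 = 0`.
    constructor
    · rw [galAct_cmCharFun, cmCharFun_conj_add hΦ]
      rfl
    · rw [map_sub, galAct_cmCharFun, galAct_cmCharFun, galAct_cmCharFun, sub_add_sub_comm,
        cmCharFun_conj_add hΦ, cmCharFun_conj_add hΦ, sub_self]⟩

theorem serreAct_cmChar (hΦ : IsCMType E Φ) (s : QBar ≃ₐ[ℚ] QBar) (ε : E →ₐ[ℚ] QBar) :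
    serreAct _ s (cmChar hΦ ε) = cmChar hΦ ((s : QBar →ₐ[ℚ] QBar).comp ε) :=
  Subtype.ext (galAct_cmCharFun Φ s ε)

theorem cmChar_conj_add (hΦ : IsCMType E Φ) (ε : E →ₐ[ℚ] QBar) :
    cmChar hΦ ((conjQBar : QBar →ₐ[ℚ] QBar).comp ε) + cmChar hΦ ε = serreOne (reflexField Φ) :=
  Subtype.ext (cmCharFun_conj_add hΦ ε)

/-! ### The homomorphism `ρ_Φ` -/

/-- Both `χ` and `ε ↦ cmChar hΦ ε` are Galois equivariant, so the family of values descends to `E ⊗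
R`. -/
theorem exists_rhoPhi_app (hΦ : IsCMType E Φ) {R : Type} [CommRing R] [Algebra ℚ R]
    (χ : serrePoints (reflexField Φ) R) :
    ∃ x : (E ⊗[ℚ] R)ˣ, ∀ ε, embUnits E ε x = χ.1 (Multiplicative.ofAdd (cmChar hΦ ε)) :=
  exists_units_of_equivariant _ fun σ ε => by
    rw [← χ.2 σ, serreAct_cmChar]

/-- The value of `ρ_Φ` on points, as a map. -/
def rhoPhiFun (hΦ : IsCMType E Φ) {R : Type} [CommRing R] [Algebra ℚ R]
    (χ : serrePoints (reflexField Φ) R) : (E ⊗[ℚ] R)ˣ :=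
  (exists_rhoPhi_app hΦ χ).choose

theorem embUnits_rhoPhiFun (hΦ : IsCMType E Φ) {R : Type} [CommRing R] [Algebra ℚ R]
    (χ : serrePoints (reflexField Φ) R) (ε : E →ₐ[ℚ] QBar) :
    embUnits E ε (rhoPhiFun hΦ χ) = χ.1 (Multiplicative.ofAdd (cmChar hΦ ε)) :=
  (exists_rhoPhi_app hΦ χ).choose_spec ε

/-- The value of `ρ_Φ` on points. -/
def rhoPhiPoints (hΦ : IsCMType E Φ) (R : Type) [CommRing R] [Algebra ℚ R] :
    serrePoints (reflexField Φ) R →* (E ⊗[ℚ] R)ˣ :=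
  MonoidHom.mk' (rhoPhiFun hΦ) fun χ χ' => by
    obtain ⟨ε⟩ : Nonempty (E →ₐ[ℚ] QBar) := inferInstance
    apply embUnits_injective ε
    rw [map_mul, embUnits_rhoPhiFun, embUnits_rhoPhiFun, embUnits_rhoPhiFun, Subgroup.coe_mul,
      MonoidHom.mul_apply]

theorem embUnits_rhoPhiPoints (hΦ : IsCMType E Φ) {R : Type} [CommRing R] [Algebra ℚ R]
    (χ : serrePoints (reflexField Φ) R) (ε : E →ₐ[ℚ] QBar) :
    embUnits E ε (rhoPhiPoints hΦ R χ) = χ.1 (Multiplicative.ofAdd (cmChar hΦ ε)) :=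
  embUnits_rhoPhiFun hΦ χ ε

/-- The homomorphism `ρ_Φ : S^{E^*} → T^E`. -/
def rhoPhi (hΦ : IsCMType E Φ) : serreGroup (reflexField Φ) ⟶ torus E where
  app R := GrpCat.ofHom (rhoPhiPoints hΦ R)
  naturality R S g := by
    refine GrpCat.hom_ext (MonoidHom.ext fun (χ : serrePoints (reflexField Φ) R) => ?_)
    refine embUnits_injective (Classical.arbitrary _) ?_
    refine (embUnits_rhoPhiPoints hΦ (R := S) _ _).trans ?_
    refine Eq.trans ?_ (qbarUnitsMap_embUnits E g.hom _ (rhoPhiPoints hΦ R χ)).symm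
    rw [embUnits_rhoPhiPoints]
    rfl

/-- In the component at `ε`, only the inclusion of `E^*` contributes to the product, with exponent
the indicator of `ε ∈ Φ`. -/
theorem rhoPhiPoints_muPhiPoints (hΦ : IsCMType E Φ) {A : Type} [CommRing A] [Algebra ℚ A]
    (u : QBar →ₐ[ℚ] A) (z : Aˣ) (χ : serrePoints (reflexField Φ) A)
    (hχ : ∀ m, χ.1 (Multiplicative.ofAdd m) = evalChar (reflexField Φ) A
      (muPhiPoints _ {reflexField.incl Φ} A u z) (Multiplicative.ofAdd m.1)) :
    rhoPhiPoints hΦ A χ = muPhiPoints E Φ A u z := by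
  classical
  refine units_splitEquiv_ext E u fun ε => ?_
  rw [splitEquiv_muPhiPoints, ← qbarMul_map]
  let q : (QBar ⊗[ℚ] A)ˣ →* Aˣ := Units.map (qbarMul u : _ →* _)
  have hq : ∀ ν, q (embUnits (reflexField Φ) ν (muPhiPoints _ {reflexField.incl Φ} A u z)) =
      if ν = reflexField.incl Φ then z else 1 := fun ν => by
    refine Units.ext ((qbarMul_map u ν _).trans ?_)
    rw [splitEquiv_muPhiPoints]
    simp only [Set.mem_singleton_iff]
    split_ifs <;> rfl
  have hc : cmCharFun Φ ε (reflexField.incl Φ) = if ε ∈ Φ then 1 else 0 :=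
    cmCharFun_comp_incl Φ ε 1
  have h : q (embUnits E ε (rhoPhiPoints hΦ A χ)) = if ε ∈ Φ then z else 1 := by
    rw [embUnits_rhoPhiPoints, hχ]
    change q (∏ ν, embUnits (reflexField Φ) ν _ ^ cmCharFun Φ ε ν) = _
    rw [map_prod, Finset.prod_eq_single (reflexField.incl Φ)]
    · rw [map_zpow, hq, if_pos rfl, hc]
      split_ifs <;> simp
    · intro ν _ hν
      rw [map_zpow, hq, if_neg hν, one_zpow]
    · simp
  refine (congrArg Units.val h).trans ?_
  split_ifs <;> rfl

theorem isRhoPhi_rhoPhi (hΦ : IsCMType E Φ) : IsRhoPhi Φ (rhoPhi hΦ) := by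
  ext A z
  exact (rhoPhiPoints_muPhiPoints hΦ A.hom.hom z _ fun m => rfl).symm

theorem embUnits_rhoPhiPoints_mul (hΦ : IsCMType E Φ) {R : Type} [CommRing R] [Algebra ℚ R]
    (χ : serrePoints (reflexField Φ) R) (ε : E →ₐ[ℚ] QBar) :
    embUnits E ε (rhoPhiPoints hΦ R χ) *
      embUnits E (ε.comp (conjCM E)) (rhoPhiPoints hΦ R χ) =
      χ.1 (Multiplicative.ofAdd (serreOne (reflexField Φ))) := by
  rw [comp_conjCM, embUnits_rhoPhiPoints, embUnits_rhoPhiPoints, ← map_mul, ← ofAdd_add, add_comm,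
    cmChar_conj_add]

theorem rhoPhiPoints_mul_conj (hΦ : IsCMType E Φ) {R : Type} [CommRing R] [Algebra ℚ R]
    (χ : serrePoints (reflexField Φ) R) (ν : Rˣ)
    (hν : (χ.1 (Multiplicative.ofAdd (serreOne (reflexField Φ))) : QBar ⊗[ℚ] R) = 1 ⊗ₜ (ν : R)) :
    (rhoPhiPoints hΦ R χ : E ⊗[ℚ] R) * Algebra.TensorProduct.map (conjCM E) (AlgHom.id ℚ R)
      (rhoPhiPoints hΦ R χ : E ⊗[ℚ] R) = 1 ⊗ₜ (ν : R) := by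
  obtain ⟨ε⟩ : Nonempty (E →ₐ[ℚ] QBar) := inferInstance
  apply map_algHom_injective ε
  rw [map_mul, ← map_comp_algHom]
  have h : Algebra.TensorProduct.map ε (AlgHom.id ℚ R) (1 ⊗ₜ (ν : R)) = 1 ⊗ₜ (ν : R) :=
    congrArg (· ⊗ₜ[ℚ] (ν : R)) (map_one ε)
  exact ((congrArg Units.val (embUnits_rhoPhiPoints_mul hΦ χ ε)).trans hν).trans h.symm

/-- The constant character is Galois invariant, so its value descends by the case `L = ℚ` of
descent. -/
theorem exists_units_serreOne {M : Type} [Field M] [NumberField M] {R : Type} [CommRing R]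
    [Algebra ℚ R] (χ : serrePoints M R) :
    ∃ ν : Rˣ, (χ.1 (Multiplicative.ofAdd (serreOne M)) : QBar ⊗[ℚ] R) = 1 ⊗ₜ (ν : R) := by
  obtain ⟨x, hx⟩ := exists_units_of_equivariant (L := ℚ) (R := R)
    (fun _ => χ.1 (Multiplicative.ofAdd (serreOne M)))
    fun σ _ => by
      rw [← χ.2 σ]
      rfl
  obtain ⟨ν₀⟩ : Nonempty (ℚ →ₐ[ℚ] QBar) := inferInstance
  refine ⟨Units.map (Algebra.TensorProduct.lid ℚ R : _ →* _) x, ?_⟩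
  rw [← hx ν₀]
  change Algebra.TensorProduct.map ν₀ (AlgHom.id ℚ R) (x : ℚ ⊗[ℚ] R) =
    1 ⊗ₜ (Algebra.TensorProduct.lid ℚ R (x : ℚ ⊗[ℚ] R))
  generalize (x : ℚ ⊗[ℚ] R) = y
  induction y with
  | zero => simp
  | add x y hx hy => simp only [map_add, tmul_add, hx, hy]
  | tmul q r =>
    have h : ν₀ q = q • (1 : QBar) := (eq_ratCast ν₀ q).trans (by rw [Rat.smul_def, mul_one])
    rw [Algebra.TensorProduct.map_tmul, h, TensorProduct.smul_tmul]
    simp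

end CMChar

/-! ### Existence of `φ` -/

section Existence

variable {K : Type} [Field K] [NumberField K] {τ : K →ₐ[ℚ] QBar}
  {r : ℕ} {Ei : Fin r → Type} [∀ i, Field (Ei i)] [∀ i, NumberField (Ei i)]
  [∀ i, NumberField.IsCMField (Ei i)] {Φ : Π i, Set (Ei i →ₐ[ℚ] QBar)}

/-- The values on points of the homomorphism `S^E → ∏ T^{E_i}` with components
`ρ_{Φ_i} ∘ N_{E/E_i^*}`. -/
def serreToPiPoints {E : Type} [Field E] [NumberField E] (hΦ : ∀ i, IsCMType (Ei i) (Φ i))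
    (j : Π i, reflexField (Φ i) →ₐ[ℚ] E) (R : QAlg) :
    serrePoints E R →* Π i, (Ei i ⊗[ℚ] R)ˣ :=
  MonoidHom.mk' (fun χ i => rhoPhiPoints (hΦ i) R (((serreNorm (j i)).app R).hom χ))
    fun χ χ' => funext fun i =>
      (congrArg (rhoPhiPoints (hΦ i) R) (map_mul ((serreNorm (j i)).app R).hom χ χ')).trans
        (map_mul (rhoPhiPoints (hΦ i) R) _ _)

theorem serreToPiPoints_mem {E : Type} [Field E] [NumberField E] (hΦ : ∀ i, IsCMType (Ei i) (Φ i))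
    (j : Π i, reflexField (Φ i) →ₐ[ℚ] E) (R : QAlg) (χ : serrePoints E R) :
    serreToPiPoints hΦ j R χ ∈ calTPoints Ei R := by
  -- One `ν` serves all `i`, since every norm pulls the constant character `1` back to the constant
  -- character `1` of `S^E`.
  obtain ⟨ν, hν⟩ := exists_units_serreOne χ
  exact ⟨ν, fun i => rhoPhiPoints_mul_conj (hΦ i) _ ν hν⟩

/-- The homomorphism `S^E → 𝒯` with components `ρ_{Φ_i} ∘ N_{E/E_i^*}`. -/
def serreToCalT {E : Type} [Field E] [NumberField E] (hΦ : ∀ i, IsCMType (Ei i) (Φ i))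
    (j : Π i, reflexField (Φ i) →ₐ[ℚ] E) : serreGroup E ⟶ calT Ei where
  app R := GrpCat.ofHom
    ((serreToPiPoints hΦ j R).codRestrict (calTPoints Ei R) (serreToPiPoints_mem hΦ j R))
  naturality R S g := by
    refine GrpCat.hom_ext (MonoidHom.ext fun χ => Subtype.ext (funext fun i => ?_))
    exact DFunLike.congr_fun
      (congrArg GrpCat.Hom.hom ((serreNorm (j i) ≫ rhoPhi (hΦ i)).naturality g)) χ

theorem serreToCalT_proj {E : Type} [Field E] [NumberField E] (hΦ : ∀ i, IsCMType (Ei i) (Φ i))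
    (j : Π i, reflexField (Φ i) →ₐ[ℚ] E) (i : Fin r) :
    serreToCalT hΦ j ≫ calTProj Ei i = serreNorm (j i) ≫ rhoPhi (hΦ i) := rfl

/-! ### Existence of `η` -/

instance formallyUnramified_numberField : Algebra.FormallyUnramified ℚ K :=
  Algebra.FormallyUnramified.of_isSeparable ℚ K

theorem mul_elem_unramified (x : K ⊗[ℚ] K) :
    x * Algebra.FormallyUnramified.elem ℚ K =
      (1 ⊗ₜ Algebra.TensorProduct.lmul' ℚ x) * Algebra.FormallyUnramified.elem ℚ K := by
  induction x with
  | zero => simp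
  | add x y hx hy => simp only [add_mul, map_add, tmul_add, hx, hy]
  | tmul a b =>
    have h := Algebra.FormallyUnramified.one_tmul_sub_tmul_one_mul_elem (R := ℚ) (S := K) a
    rw [sub_mul, sub_eq_zero] at h
    have h1 : a ⊗ₜ[ℚ] b = (1 ⊗ₜ b) * (a ⊗ₜ 1) := by simp
    have h2 : (1 : K) ⊗ₜ[ℚ] Algebra.TensorProduct.lmul' ℚ (a ⊗ₜ[ℚ] b) =
        (1 ⊗ₜ b) * (1 ⊗ₜ a) := by simp [mul_comm]
    rw [h1, mul_assoc, ← h, ← mul_assoc, ← h2, h1]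

theorem elem_unramified_mul_self :
    Algebra.FormallyUnramified.elem ℚ K * Algebra.FormallyUnramified.elem ℚ K =
      Algebra.FormallyUnramified.elem ℚ K := by
  rw [mul_elem_unramified]
  have h : Algebra.TensorProduct.lmul' ℚ (Algebra.FormallyUnramified.elem ℚ K) = 1 :=
    Algebra.FormallyUnramified.lmul_elem
  rw [h, ← Algebra.TensorProduct.one_def, one_mul]

open Classical in
-- The idempotent cuts out the diagonal factor of `K ⊗ K`. It is killed by `1 ⊗ k - k ⊗ 1`, whose
-- image `τ(k) - κ(k)` is nonzero for some `k` when `κ ≠ τ`.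
theorem lift_elem_unramified (κ τ : K →ₐ[ℚ] QBar) :
    Algebra.TensorProduct.lift κ τ (fun _ _ => Commute.all _ _)
      (Algebra.FormallyUnramified.elem ℚ K) = if κ = τ then 1 else 0 := by
  split_ifs with h
  · subst h
    have h1 : Algebra.TensorProduct.lift κ κ (fun _ _ => Commute.all _ _) =
        κ.comp (Algebra.TensorProduct.lmul' ℚ) := by
      ext x <;> simp
    have h2 : Algebra.TensorProduct.lmul' ℚ (Algebra.FormallyUnramified.elem ℚ K) = 1 :=
      Algebra.FormallyUnramified.lmul_elem
    rw [h1, AlgHom.comp_apply, h2, map_one]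
  · obtain ⟨k, hk⟩ : ∃ k, κ k ≠ τ k := by
      by_contra! hn
      exact h (AlgHom.ext hn)
    have h1 := congrArg (Algebra.TensorProduct.lift κ τ (fun _ _ => Commute.all _ _))
      (Algebra.FormallyUnramified.one_tmul_sub_tmul_one_mul_elem (R := ℚ) (S := K) k)
    rw [map_mul, map_zero, map_sub, Algebra.TensorProduct.lift_tmul,
      Algebra.TensorProduct.lift_tmul, map_one, map_one, one_mul, mul_one] at h1
    exact (mul_eq_zero.1 h1).resolve_left (sub_ne_zero.2 hk.symm)

/-- The homomorphism `a ↦ e a + (1 - e)` for an idempotent `e`. -/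
def idempotentHom {A B : Type} [CommRing A] [CommRing B] (f : A →+* B) (e : B) (he : e * e = e) :
    A →* B where
  toFun a := e * f a + (1 - e)
  map_one' := by rw [map_one, mul_one, add_sub_cancel]
  map_mul' a b := by
    rw [map_mul]
    linear_combination (f a + f b - f a * f b - 1) * he

variable (K) in
/-- The image of the separability idempotent of `K` in `K ⊗ A`, for a `K`-algebra `A`. -/
def sepIdempotent (A : AlgOver K) : K ⊗[ℚ] A.right :=
  Algebra.TensorProduct.map (AlgHom.id ℚ K) A.hom.hom (Algebra.FormallyUnramified.elem ℚ K)

theorem sepIdempotent_mul_self (A : AlgOver K) :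
    sepIdempotent K A * sepIdempotent K A = sepIdempotent K A := by
  unfold sepIdempotent
  rw [← map_mul, elem_unramified_mul_self]

theorem map_sepIdempotent {A B : AlgOver K} (f : A ⟶ B) :
    Algebra.TensorProduct.map (AlgHom.id ℚ K) f.right.hom (sepIdempotent K A) =
      sepIdempotent K B := by
  have h : f.right.hom.comp A.hom.hom = B.hom.hom :=
    AlgHom.ext fun q => congrArg (fun h => h.hom q) (Under.w f)
  unfold sepIdempotent
  rw [← h, ← AlgHom.comp_apply, ← Algebra.TensorProduct.map_comp]
  rfl

variable (K) in
/-- The cocharacter of `T^K` over `K` dual to the identity embedding of `K`. -/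
def muTaut : extendScalars K Gm ⟶ extendScalars K (torus K) where
  app A := GrpCat.ofHom (Units.map (idempotentHom
    (Algebra.TensorProduct.includeRight : A.right →ₐ[ℚ] K ⊗[ℚ] A.right).toRingHom
    (sepIdempotent K A) (sepIdempotent_mul_self A)))
  naturality A B f := by
    refine GrpCat.hom_ext (MonoidHom.ext fun (z : A.rightˣ) => Units.ext ?_)
    change sepIdempotent K B * (1 ⊗ₜ f.right.hom z.1) + (1 - sepIdempotent K B) =
      Algebra.TensorProduct.map (AlgHom.id ℚ K) f.right.hom
        (sepIdempotent K A * (1 ⊗ₜ z.1) + (1 - sepIdempotent K A))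
    rw [map_add, map_mul, map_sub, map_sepIdempotent, map_one, Algebra.TensorProduct.map_tmul,
      map_one]

/-- The idempotent `e` has component `1` at `τ` and `0` elsewhere, so `e z + (1 - e)` has components
`z` and `1`. -/
theorem muTaut_app_map (A : AlgOver QBar) (z : A.rightˣ) :
    ((muTaut K).app ((Under.map (CommAlgCat.ofHom τ)).obj A)).hom z =
      muPhiPoints K {τ} A.right A.hom.hom z := by
  classical
  refine units_splitEquiv_ext K A.hom.hom fun κ => ?_
  rw [splitEquiv_muPhiPoints]
  have he : splitEquiv K A.right A.hom.hom
      (sepIdempotent K ((Under.map (CommAlgCat.ofHom τ)).obj A)) κ = if κ = τ then 1 else 0 := by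
    have h : ∀ x : K ⊗[ℚ] K, splitEquiv K A.right A.hom.hom
        (Algebra.TensorProduct.map (AlgHom.id ℚ K) (A.hom.hom.comp τ) x) κ =
        A.hom.hom (Algebra.TensorProduct.lift κ τ (fun _ _ => Commute.all _ _) x) := by
      intro x
      induction x with
      | zero => simp
      | add x y hx hy => simp only [map_add, Pi.add_apply, hx, hy]
      | tmul a b =>
        change A.hom.hom (κ a) * A.hom.hom (τ b) = A.hom.hom (κ a * τ b)
        rw [map_mul]
    refine (h _).trans ?_
    rw [lift_elem_unramified]
    split_ifs <;> simp
  have hz : splitEquiv K A.right A.hom.hom ((1 : K) ⊗ₜ[ℚ] (z : A.right)) κ = z := by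
    change A.hom.hom (κ 1) * (z : A.right) = z
    rw [map_one, map_one, one_mul]
  let e : K ⊗[ℚ] A.right := sepIdempotent K ((Under.map (CommAlgCat.ofHom τ)).obj A)
  change splitEquiv K A.right A.hom.hom e κ = _ at he
  change splitEquiv K A.right A.hom.hom (e * ((1 : K) ⊗ₜ[ℚ] (z : A.right)) + (1 - e)) κ = _
  rw [map_add, map_mul, map_sub, map_one, Pi.add_apply, Pi.mul_apply, Pi.sub_apply, he, hz]
  simp only [Set.mem_singleton_iff]
  split_ifs <;> simp

/-- Any homomorphism over `ℚ` with the right value on `μ_τ` yields `μ'_cm` over `K`, because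
`muTaut` is a form of `μ_τ` over `K`. -/
theorem isMuCM_of_isCMHom {h : torus K ⟶ calT Ei} (hh : IsCMHom τ Φ h) :
    IsMuCM τ Φ (muTaut K ≫ extendScalarsMap K h) := by
  intro A i
  rw [← hh i]
  ext z
  exact congrArg (fun t : (K ⊗[ℚ] A.right)ˣ => ((h.app A.right).hom t : calTPoints Ei A.right).1 i)
    (muTaut_app_map A z)

/-! ### Existence and comparison of the two homomorphisms -/

variable (E : IntermediateField ℚ K) (hΦE : ∀ i, reflexField (Φ i) ≤ E.map τ) (ξ : Π i, Ei i)

theorem exists_isVarphi (hΦ : ∀ i, IsCMType (Ei i) (Φ i)) : ∃ φ, IsVarphi τ E Φ hΦE ξ φ := by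
  refine ⟨_, fun i => rhoPhi (hΦ i),
    serreToCalT hΦ fun i => inclOfLE τ E (reflexField (Φ i)) (hΦE i),
    fun i => isRhoPhi_rhoPhi (hΦ i), fun i => ?_, rfl⟩
  exact serreToCalT_proj hΦ (fun i => inclOfLE τ E (reflexField (Φ i)) (hΦE i)) i

theorem exists_isEta {E : IntermediateField ℚ K} (hΦE : ∀ i, reflexField (Φ i) ≤ E.map τ)
    (ξ : Π i, Ei i) (hΦ : ∀ i, IsCMType (Ei i) (Φ i)) : ∃ η, IsEta τ Φ ξ η := by
  obtain ⟨_, ρ, f, hρ, hf, -⟩ := exists_isVarphi E hΦE ξ hΦ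
  exact ⟨_, _, isMuCM_of_isCMHom (isCMHom_of_isRhoPhi E hΦE hρ hf), rfl⟩

variable {E hΦE ξ}

theorem IsVarphi.eq_of_isEta {φ η : torus K ⟶ GSp (psiE ξ)} (hφ : IsVarphi τ E Φ hΦE ξ φ)
    (hη : IsEta τ Φ ξ η) : φ = η := by
  obtain ⟨ρ, f, hρ, hf, rfl⟩ := hφ
  obtain ⟨μ, hμ, rfl⟩ := hη
  have h := (isCMHom_of_isRhoPhi E hΦE hρ hf).unique (isCMHom_of_isMuCM hμ)
  simpa only [Category.assoc] using congrArg (fun t => t ≫ calTToGSp ξ) h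

end Existence

end

theorem mainTheorem2 (K : Type) [Field K] [NumberField K] (τ : K →ₐ[ℚ] QBar)
    (E : IntermediateField ℚ K)
    (hE : IsGreatest {F : IntermediateField ℚ K | NumberField.IsCMField F} E)
    (r : ℕ) (Ei : Fin r → Type) [∀ i, Field (Ei i)] [∀ i, NumberField (Ei i)]
    [∀ i, NumberField.IsCMField (Ei i)] (Φ : Π i, Set (Ei i →ₐ[ℚ] QBar))
    (hΦ : ∀ i, IsCMType (Ei i) (Φ i))
    (hΦE : ∀ i, reflexField (Φ i) ≤ E.map τ)
    (ξ : Π i, Ei i) (hξ : ∀ i, conjCM (Ei i) (ξ i) = -ξ i)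
    (hξ' : ∀ i, IntermediateField.adjoin ℚ {ξ i} = ⊤) :
    (∃! φ : torus K ⟶ GSp (psiE ξ), IsVarphi τ E Φ hΦE ξ φ) ∧
    (∃! η : torus K ⟶ GSp (psiE ξ), IsEta τ Φ ξ η) ∧
    ∀ φ η : torus K ⟶ GSp (psiE ξ),
      IsVarphi τ E Φ hΦE ξ φ → IsEta τ Φ ξ η → φ = η := by
  obtain ⟨φ₀, hφ₀⟩ := exists_isVarphi E hΦE ξ hΦ
  obtain ⟨η₀, hη₀⟩ := exists_isEta hΦE ξ hΦ
  -- Every `φ` equals every `η`, so one solution of each kind forces uniqueness of the other kind.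
  exact ⟨⟨φ₀, hφ₀, fun φ hφ => (hφ.eq_of_isEta hη₀).trans (hφ₀.eq_of_isEta hη₀).symm⟩,
    ⟨η₀, hη₀, fun η hη => (hφ₀.eq_of_isEta hη).symm.trans (hφ₀.eq_of_isEta hη₀)⟩,
    fun φ η hφ hη => hφ.eq_of_isEta hη⟩
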